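/- Let $k$ be a non-Archimedean field, i.e. a field that is complete with respect to a multiplicative non-Archimedean norm (the trivial norm is allowed), with valuation ring $k^\circ=\{|a|\le 1\}$ and residue field $\widetilde k$. Let $X$ be a variety over $k$, i.e. a separated integral scheme of finite type over $k$, with function field $K(X)$. Let $x\in X^{\mathrm{val}}$, i.e. $x$ is a point of the Berkovich analytification $X^{\mathrm{an}}$ lying over the generic point of $X$; in other words, $x$ is an absolute value on $K(X)$ that extends the one of $k$. Let $\mathscr H(x)$ be the completion of $K(X)$ with respect to $x$, let $\mathscr H(x)^\circ=\{|f|_x\le 1\}$ be its valuation ring and $\widetilde{\mathscr H(x)}$ the residue field of $\mathscr H(x)^\circ$ (the double residue field). A model of $X$ is a separated flat integral $k^\circ$-scheme $\mathcal X$ of finite type together with an isomorphism $\mathcal X\times_{\operatorname{Spec}k^\circ}\operatorname{Spec}k\cong X$ over $k$. A blow-up of $X$ is the blow-up of $X$ along a coherent sheaf of ideals. If $\mathcal X$ is a model or a nonempty blow-up of $X$, there is a canonical morphism $\operatorname{Spec}\mathscr H(x)\to\operatorname{Spec}K(X)\to\mathcal X$. If it extends to a $k^\circ$-morphism $\operatorname{Spec}\mathscr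 H(x)^\circ\to\mathcal X$, the extension is unique, we say that the center of $x$ in $\mathcal X$ exists, and the center $c_{\mathcal X}(x)\in\mathcal X$ is the image of the closed point; there is then a canonical inclusion $\kappa(c_{\mathcal X}(x))\hookrightarrow\widetilde{\mathscr H(x)}$. Let $B(X,x)$ be the collection of all blow-ups $\mathcal X$ of $X$ in which the center of $x$ exists, if $k=k^\circ$, and of all models $\mathcal X$ of $X$ in which the center of $x$ exists, if $k\ne k^\circ$. Let $X^*$ be the set of all $x\in X^{\mathrm{val}}$ such that $\kappa(c_{\mathcal X}(x))=\widetilde{\mathscr H(x)}$ for some $\mathcal X\in B(X,x)$. Suppose that $B(X,x)\neq\emptyset$. Then the following are equivalent: (i) $x\in X^*$; (ii) $\widetilde{\mathscr H(x)}$ is finitely generated as a field over $\kappa(c_{\mathcal X}(x))$ for every $\mathcal X\in B(X,x)$; (iii) $\widetilde{\mathscr H(x)}$ is finitely generated as a field over $\widetilde k$. -/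

import Mathlib

open CategoryTheory AlgebraicGeometry

universe u

noncomputable section

namespace BerkovichCenter

/-! ### Ultrametric fields, their valuation rings and residue fields -/

section Fields

/-- The valuation ring `K° = {a : ‖a‖ ≤ 1}` of an ultrametric normed field. The absolute value may
be trivial, in which case `K° = K`. -/
def unitBall (K : Type u) [NormedField K] [IsUltrametricDist K] : ValuationSubring K :=
  (NormedField.valuation (K := K)).valuationSubring

lemma mem_unitBall {K : Type u} [NormedField K] [IsUltrametricDist K] {a : K} :
    a ∈ unitBall K ↔ ‖a‖ ≤ 1 := Iff.rfl

/-- The residue field `K° / K°°` of an ultrametric normed field, where `K°°`, the set of elements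
of norm less than one, is the maximal ideal of the valuation ring `K°`. -/
abbrev ResField (K : Type u) [NormedField K] [IsUltrametricDist K] : Type u :=
  IsLocalRing.ResidueField (unitBall K)

variable {K L : Type u} [NormedField K] [IsUltrametricDist K] [NormedField L]
  [IsUltrametricDist L]

lemma isUnit_unitBall_iff {a : unitBall K} : IsUnit a ↔ ‖(a : K)‖ = 1 := by
  have h := (NormedField.valuation (K := K)).valuationSubring.valuation_eq_one_iff a
  rw [show IsUnit a ↔ _ from h]
  have h2 := (Valuation.isEquiv_valuation_valuationSubring (NormedField.valuation (K := K)))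
  rw [← h2.eq_one_iff_eq_one]
  simp only [NormedField.valuation_apply, ← NNReal.coe_inj, coe_nnnorm, NNReal.coe_one]

/-- The map `K° → L°` induced by a norm-preserving homomorphism of fields `K → L`. -/
def unitBallMap (f : K →+* L) (hf : ∀ a, ‖f a‖ = ‖a‖) : unitBall K →+* unitBall L :=
  (f.comp (unitBall K).subtype).codRestrict (unitBall L).toSubring fun a => by
    change ‖f a‖ ≤ 1
    rw [hf]
    exact a.2

instance isLocalHom_unitBallMap (f : K →+* L) (hf : ∀ a, ‖f a‖ = ‖a‖) :
    IsLocalHom (unitBallMap f hf) where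
  map_nonunit a ha := by
    rw [isUnit_unitBall_iff] at ha ⊢
    rw [← hf]
    exact ha

/-- The map on residue fields induced by a norm-preserving homomorphism of fields. -/
def resFieldMap (f : K →+* L) (hf : ∀ a, ‖f a‖ = ‖a‖) : ResField K →+* ResField L :=
  IsLocalRing.ResidueField.map (unitBallMap f hf)

end Fields

/-- Via `f`, the field `L` is finitely generated over the field `K` as a field. -/
def FieldFG {K L : Type u} [Field K] [Field L] (f : K →+* L) : Prop :=
  letI := f.toAlgebra
  (⊤ : IntermediateField K L).FG

/-! ### Points of the Berkovich analytification -/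

section Analytification

variable {k : Type u} [NormedField k] [IsUltrametricDist k]
  {X : Scheme.{u}} (s : X ⟶ Spec (.of k))

/-- The structure homomorphism `k → κ(p)` of the residue field at a point of a `k`-scheme. -/
def scalar (p : X) : k →+* X.residueField p :=
  (Spec.preimage (X.fromSpecResidueField p ≫ s)).hom

/-- A point of the analytification `X^an` of a `k`-scheme `X` (locally of finite type): a point
`p` of `X` together with an absolute value on `κ(p)` that extends the one of `k`.
On an affine open `Spec A` these are the multiplicative seminorms on `A` that extend the absolute
value of `k`, the point `p` being the kernel of the seminorm. -/
structure AnPoint where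
  /-- the image under `X^an → X` -/
  pt : X
  /-- the absolute value on `κ(pt)` -/
  abv : AbsoluteValue (X.residueField pt) ℝ
  abv_scalar : ∀ c : k, abv (scalar s pt c) = ‖c‖

/-- `X^val`: the points of `X^an` that are valuations on the function field, that is, those lying
over the generic point of `X`. -/
def Xval [IrreducibleSpace X] : Set (AnPoint s) :=
  {x | x.pt = genericPoint X}

namespace AnPoint

variable {s} (x : AnPoint s)

/-- The Berkovich residue field `ℋ(x)`: the completion of `κ(pt)` with respect to `x`. -/
abbrev H : Type u := x.abv.Completion

/-- The inclusion `κ(pt) → ℋ(x)`. -/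
def toH : X.residueField x.pt →+* x.H :=
  (UniformSpace.Completion.coeRingHom (α := WithAbs x.abv)).comp
    (WithAbs.equiv x.abv).symm.toRingHom

lemma norm_toH (a : X.residueField x.pt) : ‖x.toH a‖ = x.abv a :=
  UniformSpace.Completion.norm_coe _

/-- The inclusion `k → ℋ(x)`. -/
def scalarH : k →+* x.H := x.toH.comp (scalar s x.pt)

lemma norm_scalarH (c : k) : ‖x.scalarH c‖ = ‖c‖ := by
  rw [← x.abv_scalar c, ← x.norm_toH]
  rfl

instance : IsUltrametricDist x.H :=
  IsUltrametricDist.isUltrametricDist_of_forall_norm_natCast_le_one fun n => by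
    rw [← map_natCast x.scalarH n, x.norm_scalarH]
    exact IsUltrametricDist.norm_natCast_le_one k n

/-- The morphism `Spec ℋ(x) → Spec ℋ(x)°`. -/
def specHToBall : Spec (.of x.H) ⟶ Spec (.of (unitBall x.H)) :=
  Spec.map (CommRingCat.ofHom (unitBall x.H).subtype)

/-- The morphism `Spec ℋ(x) → Spec κ(pt)`. -/
def specHToPt : Spec (.of x.H) ⟶ Spec (X.residueField x.pt) :=
  Spec.map (CommRingCat.ofHom x.toH)

/-- The morphism `Spec ℋ(x)° → Spec k°`. -/
def specBallToBase : Spec (.of (unitBall x.H)) ⟶ Spec (.of (unitBall k)) :=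
  Spec.map (CommRingCat.ofHom (unitBallMap x.scalarH x.norm_scalarH))

/-- The inclusion of the residue field of `k` in the double residue field of `x`, which is the
residue field of `ℋ(x)`. -/
def resScalar : ResField k →+* ResField x.H :=
  resFieldMap x.scalarH x.norm_scalarH

end AnPoint

end Analytification

/-- The morphism `Spec k → Spec k°`. -/
def specToBall (k : Type u) [NormedField k] [IsUltrametricDist k] :
    Spec (.of k) ⟶ Spec (.of (unitBall k)) :=
  Spec.map (CommRingCat.ofHom (unitBall k).subtype)

/-! ### Blow-ups -/

section BlowUp

variable {R : Type u} [CommRing R] (I : Ideal R)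

/-- The degree `n` part `I ^ n * t ^ n` of the Rees algebra `⨁ I ^ n * t ^ n ⊆ R[t]`. -/
def reesGrading (n : ℕ) : Submodule R (reesAlgebra I) :=
  (LinearMap.range (Polynomial.monomial (R := R) n)).comap (reesAlgebra I).val.toLinearMap

lemma mem_reesGrading {n : ℕ} {f : reesAlgebra I} :
    f ∈ reesGrading I n ↔ ∃ r : R, Polynomial.monomial n r = (f : Polynomial R) := Iff.rfl

/-- The homogeneous component of degree `n`. -/
def reesComponent (f : reesAlgebra I) (n : ℕ) : reesGrading I n :=
  ⟨⟨Polynomial.monomial n ((f : Polynomial R).coeff n),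
    reesAlgebra.monomial_mem.mpr ((mem_reesAlgebra_iff I _).mp f.2 n)⟩, ⟨_, rfl⟩⟩

instance : SetLike.GradedMonoid (reesGrading I) where
  one_mem := ⟨1, rfl⟩
  mul_mem := by
    rintro i j f g ⟨a, ha⟩ ⟨b, hb⟩
    exact ⟨a * b, by
      simp only [AlgHom.toLinearMap_apply, Subalgebra.coe_val] at ha hb ⊢
      rw [MulMemClass.coe_mul, ← ha, ← hb, Polynomial.monomial_mul_monomial]⟩

lemma reesGrading_key (g : DirectSum ℕ fun i => reesGrading I i) (n : ℕ) :
    Polynomial.monomial n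
      ((DirectSum.coeAddMonoidHom (reesGrading I) g : Polynomial R).coeff n) =
        ((g n : reesAlgebra I) : Polynomial R) := by
  induction g using DirectSum.induction_on with
  | zero => simp
  | of i y =>
    obtain ⟨y, r, hr⟩ := y
    simp only [AlgHom.toLinearMap_apply, Subalgebra.coe_val] at hr
    rw [DirectSum.coeAddMonoidHom_of]
    by_cases h : i = n
    · subst h
      rw [DirectSum.of_eq_same]
      simp [← hr]
    · rw [DirectSum.of_eq_of_ne _ _ _ (Ne.symm h)]
      simp [← hr, Polynomial.coeff_monomial, h]
  | add a b ha hb => simp_all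

lemma reesGrading_injective :
    Function.Injective (DirectSum.coeAddMonoidHom (reesGrading I)) := fun g g' h =>
  DFinsupp.ext fun n => Subtype.ext <| Subtype.ext <| by
    rw [← reesGrading_key, ← reesGrading_key, h]

/-- The decomposition of an element of the Rees algebra into homogeneous components. -/
def reesDecompose (f : reesAlgebra I) : DirectSum ℕ fun i => reesGrading I i :=
  ∑ n ∈ (f : Polynomial R).support, DirectSum.of _ n (reesComponent I f n)

lemma coe_reesDecompose (f : reesAlgebra I) :
    DirectSum.coeAddMonoidHom (reesGrading I) (reesDecompose I f) = f := by
  apply Subtype.ext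
  simp only [reesDecompose, map_sum, DirectSum.coeAddMonoidHom_of, reesComponent]
  rw [AddSubmonoidClass.coe_finsetSum]
  exact (Polynomial.as_sum_support (f : Polynomial R)).symm

instance : DirectSum.Decomposition (reesGrading I) where
  decompose' := reesDecompose I
  left_inv := coe_reesDecompose I
  right_inv _ := reesGrading_injective I (coe_reesDecompose I _)

instance : GradedAlgebra (reesGrading I) where

/-- The blow-up `Proj (⨁ I ^ n)` of `Spec R` along the ideal `I`. -/
def affineBlowUp : Scheme.{u} := Proj (reesGrading I)

/-- The projection of the blow-up of `Spec R` along `I` to `Spec R`. -/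
def affineBlowUpToSpec : affineBlowUp I ⟶ Spec (.of R) :=
  Proj.toSpecZero (reesGrading I) ≫
    Spec.map (CommRingCat.ofHom (algebraMap R (reesGrading I 0)))

/-- `π : Y → X` is the blow-up of `X` along the quasi-coherent sheaf of ideals `I`: over every
affine open `U` of `X` it is isomorphic to `Proj (⨁ I(U) ^ n) → U`. (Such an isomorphism over `U`
is unique, by the universal property of blow-ups, so that the local isomorphisms glue to one of
`Y` with the relative `Proj` of `⨁ I ^ n` over `X`.) -/
def IsBlowUpAlong {X Y : Scheme.{u}} (π : Y ⟶ X) (I : X.IdealSheafData) : Prop :=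
  ∀ U : X.affineOpens, ∃ e : (π ⁻¹ᵁ U.1).toScheme ≅ affineBlowUp (I.ideal U),
    e.hom ≫ affineBlowUpToSpec (I.ideal U) = (π ∣_ U.1) ≫ U.2.isoSpec.hom

end BlowUp

/-! ### Models, centers and the set `B(X, x)` -/

section Models

variable {k : Type u} [NormedField k] [IsUltrametricDist k]
  {X : Scheme.{u}} (s : X ⟶ Spec (.of k))

/-- `𝒳` with `j : X → 𝒳` is a model of `X`: a separated flat integral scheme of finite type over
`k°` whose base change to `k` is identified with `X` (by `j`). -/
structure IsModel {𝒳 : Scheme.{u}} (t : 𝒳 ⟶ Spec (.of (unitBall k))) (j : X ⟶ 𝒳) : Prop where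
  isIntegral : IsIntegral 𝒳
  flat : Flat t
  locallyOfFiniteType : LocallyOfFiniteType t
  quasiCompact : QuasiCompact t
  isSeparated : IsSeparated t
  isPullback : IsPullback j s t (specToBall k)

variable {s}

/-- A scheme `𝒳` over `k°`, with a morphism `Spec κ(pt) → 𝒳` (through which `x` is seen as a
valuation on `𝒳`), in which `x` has a center: `Spec ℋ(x) → Spec κ(pt) → 𝒳` extends to a
`k°`-morphism `Spec ℋ(x)° → 𝒳`. If `𝒳` is separated, the extension is unique. -/
structure Centered (x : AnPoint s) where
  /-- the scheme `𝒳` -/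
  scheme : Scheme.{u}
  /-- its structure morphism -/
  toBase : scheme ⟶ Spec (.of (unitBall k))
  /-- the morphism `Spec κ(pt) → 𝒳` -/
  fromPt : Spec (X.residueField x.pt) ⟶ scheme
  /-- the extension to `Spec ℋ(x)°` -/
  lift : Spec (.of (unitBall x.H)) ⟶ scheme
  specHToBall_lift : x.specHToBall ≫ lift = x.specHToPt ≫ fromPt
  lift_toBase : lift ≫ toBase = x.specBallToBase

namespace Centered

variable {x : AnPoint s} (Z : Centered x)

/-- The center `c_𝒳(x)`: the image of the closed point of `Spec ℋ(x)°`. -/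
def center : Z.scheme := Z.lift (IsLocalRing.closedPoint (unitBall x.H))

/-- The local homomorphism `𝒪_{𝒳, c} → ℋ(x)°` at the center `c`, followed by the reduction map
to the double residue field. -/
def stalkMap : Z.scheme.presheaf.stalk Z.center ⟶ .of (ResField x.H) :=
  Scheme.stalkClosedPointTo Z.lift ≫ CommRingCat.ofHom (IsLocalRing.residue (unitBall x.H))

instance : IsLocalHom Z.stalkMap.hom :=
  inferInstanceAs (IsLocalHom ((IsLocalRing.residue (unitBall x.H)).comp
    (Scheme.stalkClosedPointTo Z.lift).hom))

/-- The canonical inclusion of the residue field `κ(c_𝒳(x))` of the center in the double residue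
field of `x`. -/
def resCenter : Z.scheme.residueField Z.center →+* ResField x.H :=
  (Z.scheme.descResidueField Z.stalkMap).hom

/-- `𝒳` is a model of `X`, and `x` is seen as a valuation on it through `X → 𝒳`. -/
def IsModelOf : Prop :=
  ∃ j : X ⟶ Z.scheme, IsModel s Z.toBase j ∧ Z.fromPt = X.fromSpecResidueField x.pt ≫ j

/-- `𝒳` is a blow-up of `X` along some (quasi-)coherent sheaf of ideals, and `x` is seen as a
valuation on it by lifting `Spec κ(pt) → X`. For a valuation `x`, the point `pt` is the generic
point of `X`, over which the blow-up along a nonzero ideal is an isomorphism (so that the lift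
exists and is unique); the blow-up along the zero ideal is empty and admits no lift. -/
def IsBlowUpOf : Prop :=
  ∃ (π : Z.scheme ⟶ X) (I : X.IdealSheafData), IsBlowUpAlong π I ∧
    Z.toBase = π ≫ s ≫ specToBall k ∧ Z.fromPt ≫ π = X.fromSpecResidueField x.pt

end Centered

/-- `B(X, x)`: if `k = k°`, all blow-ups of `X` in which `x` has a center; if `k ≠ k°`, all models
of `X` in which `x` has a center. -/
def B (x : AnPoint s) : Set (Centered x) :=
  {Z | (unitBall k = ⊤ → Z.IsBlowUpOf) ∧ (unitBall k ≠ ⊤ → Z.IsModelOf)}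

variable (s) in
/-- `X^*`: the valuations `x` such that the residue field of the center of `x` in some member of
`B(X, x)` is the whole double residue field of `x`. -/
def Xstar [IrreducibleSpace X] : Set (AnPoint s) :=
  {x | x ∈ Xval s ∧ ∃ Z ∈ B x, Function.Surjective Z.resCenter}

end Models

end BerkovichCenter

end

/-!
Let `x` be a valuation on `X` and `Z` a member of `B(X, x)`. The residue field `κ(c)` of the center
of `x` in `Z` is finitely generated over the residue field of `k`, because `Z` is locally of finite
type over `k°`: for a model by definition, and for a blow-up because the Rees algebra of an ideal in
a noetherian ring is finitely generated (`IsBlowUpAlong.locallyOfFiniteType`). Hence the double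
residue field is finitely generated over `κ(c)` if and only if it is so over the residue field of
`k` (`Centered.fieldFG_resCenter_iff`). This gives the equivalence of (ii) and (iii), where
`B(X, x) ≠ ∅` is used for (ii) ⇒ (iii), and also (i) ⇒ (iii).

For (iii) ⇒ (i), choose finitely many generators of the double residue field. As `κ(pt)` is dense in
`ℋ(x)`, they are reductions of elements `f` of `κ(pt)` with `|f| ≤ 1`
(`AnPoint.exists_finset_of_fieldFG`), and it suffices to find a member of `B(X, x)` on which all these
`f` are regular at the center of `x`.

* If `k ≠ k°`, then the `f` are regular on some affine open `W = Spec R` of `X`. Scaling by elements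
  of `k` gives generators of the `k`-algebra `R` that include the `f` and are bounded by one at
  `x`; let `A` be the `k°`-algebra which they generate. Then `Spec A` is a model of `W`, being
  torsion free over a valuation ring, and gluing it with `X` along `W` gives a model of `X`
  (`exists_isModelOf_forall_residue_mem_range`). It is separated although `X` and `Spec A`
  only overlap in `W`, because `W` is the whole part of `Spec A` over the open point of `Spec k°`.

* If `k = k°`, then `x` has a center in `X`, as it has one in some blow-up. On an affine neighbourhood
  `U` of it, the elements of norm at most one include all functions, and `f = a_f / b` with a common
  denominator `b`. Blowing up an ideal sheaf that restricts to `(b, a_f : f)` on `U` gives the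
  required member of `B(X, x)`: all elements of this ideal are bounded by `|b|` at `x`, so that the
  center of `x` lies in the chart `D₊(b t)`, whose functions are the `g / b ^ n` with `g` in the
  `n`-th power of the ideal (`exists_isBlowUpOf_forall_residue_mem_range`). The blow-up exists globally
  because `Proj (⨁ I ^ n)` is compatible with flat base change (`isPullback_affineBlowUpMap`), so that
  the blow-ups of the affine opens of `X` glue (`exists_isBlowUpAlong`).
-/

namespace BerkovichCenter

/-! ### Finitely generated extensions of residue fields -/

lemma fieldFG_iff {K L : Type u} [Field K] [Field L] (f : K →+* L) :
    FieldFG f ↔ f.EssFiniteType := by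
  let _ := f.toAlgebra
  exact IntermediateField.fg_top_iff

/-- The homomorphism `R → κ(p)` of the residue field at a point of a scheme over `Spec R`. -/
noncomputable def toResidueField {R : Type u} [CommRing R] {Y : Scheme.{u}}
    (t : Y ⟶ Spec (.of R)) (p : Y) : R →+* Y.residueField p :=
  (Spec.preimage (Y.fromSpecResidueField p ≫ t)).hom

lemma map_evaluation_fromSpec {Y : Scheme.{u}} {U : Y.Opens} (hU : IsAffineOpen U) (p : Y)
    (hp : p ∈ U) :
    Spec.map (Y.evaluation U p hp) ≫ hU.fromSpec = Y.fromSpecResidueField p := by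
  rw [Scheme.fromSpecResidueField, ← hU.fromSpecStalk_eq_fromSpecStalk hp,
    IsAffineOpen.fromSpecStalk, ← Spec.map_comp_assoc]
  rfl

lemma essFiniteType_evaluation {Y : Scheme.{u}} {U : Y.Opens} (hU : IsAffineOpen U) (p : Y)
    (hp : p ∈ U) : (Y.evaluation U p hp).hom.EssFiniteType := by
  have h1 : (Y.presheaf.germ U p hp).hom.EssFiniteType := by
    let _ := (Y.presheaf.germ U p hp).hom.toAlgebra
    have : IsLocalization.AtPrime (Y.presheaf.stalk p) (hU.primeIdealOf ⟨p, hp⟩).asIdeal :=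
      hU.isLocalization_stalk ⟨p, hp⟩
    exact Algebra.EssFiniteType.of_isLocalization _
      (hU.primeIdealOf ⟨p, hp⟩).asIdeal.primeCompl
  have h2 : (Y.residue p).hom.EssFiniteType :=
    (RingHom.FiniteType.of_surjective _ (Y.residue_surjective p)).essFiniteType
  exact h1.comp h2

lemma essFiniteType_toResidueField {R : Type u} [CommRing R] {Y : Scheme.{u}}
    (t : Y ⟶ Spec (.of R)) [LocallyOfFiniteType t] (p : Y) :
    (toResidueField t p).EssFiniteType := by
  obtain ⟨U, hU, hp, -⟩ := Y.isBasis_affineOpens.exists_subset_of_mem_open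
    (Set.mem_univ p) isOpen_univ
  obtain ⟨U, hU, rfl⟩ := hU
  have := hU.isOpenImmersion_fromSpec
  have hφ : (Spec.preimage (hU.fromSpec ≫ t)).hom.FiniteType := by
    rw [← HasRingHomProperty.Spec_iff (P := @LocallyOfFiniteType), Spec.map_preimage]
    infer_instance
  have : toResidueField t p = (Y.evaluation U p hp).hom.comp
      (Spec.preimage (hU.fromSpec ≫ t)).hom := by
    rw [← CommRingCat.hom_comp, toResidueField]
    congr 1
    apply Spec.map_injective
    rw [Spec.map_comp, Spec.map_preimage, Spec.map_preimage,
      ← map_evaluation_fromSpec hU p hp, Category.assoc]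
  rw [this]
  exact hφ.essFiniteType.comp (essFiniteType_evaluation hU p hp)

lemma essFiniteType_residue (R : Type u) [CommRing R] [IsLocalRing R] :
    (IsLocalRing.residue R).EssFiniteType :=
  (RingHom.FiniteType.of_surjective _ IsLocalRing.residue_surjective).essFiniteType

section Center

variable {k : Type u} [NormedField k] [IsUltrametricDist k]
  {X : Scheme.{u}} {s : X ⟶ Spec (.of k)} {x : AnPoint s}

lemma AnPoint.resScalar_comp_residue :
    x.resScalar.comp (IsLocalRing.residue (unitBall k)) =
      (IsLocalRing.residue (unitBall x.H)).comp (unitBallMap x.scalarH x.norm_scalarH) :=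
  RingHom.ext fun _ => rfl

/-- The inclusion `κ(c) → ℋ(x)°/ℋ(x)°°` as a morphism of `CommRingCat`. -/
noncomputable def Centered.resCenterHom (Z : Centered x) :
    Z.scheme.residueField Z.center ⟶ .of (ResField x.H) :=
  Z.scheme.descResidueField Z.stalkMap

lemma Centered.map_resCenterHom (Z : Centered x) :
    Spec.map Z.resCenterHom ≫ Z.scheme.fromSpecResidueField Z.center =
      Spec.map (CommRingCat.ofHom (IsLocalRing.residue (unitBall x.H))) ≫ Z.lift := by
  refine (Scheme.descResidueField_fromSpecResidueField _ Z.stalkMap).trans ?_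
  have h : ∀ {p : Z.scheme} (f : Z.scheme.presheaf.stalk p ⟶ .of (unitBall x.H)),
      Spec.map (f ≫ CommRingCat.ofHom (IsLocalRing.residue (unitBall x.H))) ≫
        Z.scheme.fromSpecStalk p =
      Spec.map (CommRingCat.ofHom (IsLocalRing.residue (unitBall x.H))) ≫
        Spec.map f ≫ Z.scheme.fromSpecStalk p := fun f => by
    rw [Spec.map_comp, Category.assoc]
  refine (h _).trans ?_
  rw [Scheme.Spec_stalkClosedPointTo_fromSpecStalk Z.lift]

lemma Centered.resCenter_comp_toResidueField (Z : Centered x) :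
    Z.resCenter.comp (toResidueField Z.toBase Z.center) =
      (IsLocalRing.residue (unitBall x.H)).comp (unitBallMap x.scalarH x.norm_scalarH) := by
  have : (Spec.preimage (Z.scheme.fromSpecResidueField Z.center ≫ Z.toBase)) ≫ Z.resCenterHom =
      CommRingCat.ofHom (unitBallMap x.scalarH x.norm_scalarH) ≫
        CommRingCat.ofHom (IsLocalRing.residue (unitBall x.H)) := by
    apply Spec.map_injective
    rw [Spec.map_comp, Spec.map_preimage, reassoc_of% Z.map_resCenterHom, Z.lift_toBase,
      Spec.map_comp]
    rfl
  exact congrArg CommRingCat.Hom.hom this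

/-- The functions on an open chart through which `Spec ℋ(x)°` factors have reductions that lie in
the residue field of the center. -/
lemma Centered.residue_mem_range_resCenter (Z : Centered x) {A : CommRingCat.{u}}
    (g : Spec A ⟶ Z.scheme) [IsOpenImmersion g] (φ : A ⟶ .of (unitBall x.H))
    (h : Z.lift = Spec.map φ ≫ g) (a : A) :
    IsLocalRing.residue (unitBall x.H) (φ a) ∈ Z.resCenter.range := by
  have hc : Set.range (Z.scheme.fromSpecResidueField Z.center) ⊆ Set.range g := by
    rw [Scheme.range_fromSpecResidueField, Set.singleton_subset_iff, center, h]
    exact ⟨_, rfl⟩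
  obtain ⟨ψ, hψ⟩ := Spec.map_surjective (IsOpenImmersion.lift g _ hc)
  have : ψ ≫ Z.resCenterHom =
      φ ≫ CommRingCat.ofHom (IsLocalRing.residue (unitBall x.H)) := by
    apply Spec.map_injective
    rw [← cancel_mono g, Spec.map_comp, Spec.map_comp, Category.assoc, Category.assoc, hψ,
      IsOpenImmersion.lift_fac, Z.map_resCenterHom, h]
  exact ⟨ψ a, congr($this a)⟩

/-- If `𝒳` is locally of finite type over `k°`, then `κ(c)` is finitely generated over the residue
field of `k`, so that it makes no difference over which of the two one asks for finite
generation. -/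
lemma Centered.fieldFG_resCenter_iff (Z : Centered x) [LocallyOfFiniteType Z.toBase] :
    FieldFG Z.resCenter ↔ FieldFG x.resScalar := by
  rw [fieldFG_iff, fieldFG_iff, ← (essFiniteType_residue (unitBall k)).comp_iff,
    x.resScalar_comp_residue, ← Z.resCenter_comp_toResidueField,
    (essFiniteType_toResidueField Z.toBase Z.center).comp_iff]

/-- Every element of the double residue field is the reduction of an element of `κ(pt)`, as
`κ(pt)` is dense in `ℋ(x)`. -/
lemma AnPoint.exists_residue_toH_eq (y : ResField x.H) :
    ∃ (f : X.residueField x.pt) (hf : x.toH f ∈ unitBall x.H),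
      IsLocalRing.residue (unitBall x.H) ⟨x.toH f, hf⟩ = y := by
  obtain ⟨y, rfl⟩ := IsLocalRing.residue_surjective y
  have hd : DenseRange x.toH :=
    (UniformSpace.Completion.denseRange_coe (α := WithAbs x.abv)).comp
      (WithAbs.equiv x.abv).symm.surjective.denseRange
      (UniformSpace.Completion.continuous_coe _)
  obtain ⟨f, hf⟩ := Metric.denseRange_iff.mp hd (y : x.H) 1 one_pos
  have hlt : ‖x.toH f - y‖ < 1 := by rwa [← dist_eq_norm, dist_comm]
  have hmem : x.toH f - y ∈ unitBall x.H := mem_unitBall.mpr hlt.le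
  have hf : x.toH f ∈ unitBall x.H := by
    simpa using add_mem hmem y.2
  refine ⟨f, hf, ?_⟩
  rw [← sub_eq_zero, ← map_sub, IsLocalRing.residue_eq_zero_iff, IsLocalRing.mem_maximalIdeal,
    mem_nonunits_iff, isUnit_unitBall_iff]
  exact hlt.ne

/-- If the double residue field is finitely generated over the residue field of `k`, then there
are finitely many elements of norm at most one of `κ(pt)` such that `κ(c)` is the whole double
residue field as soon as it contains their reductions. -/
lemma AnPoint.exists_finset_of_fieldFG (h : FieldFG x.resScalar) :
    ∃ F : Finset (X.residueField x.pt), (∀ f ∈ F, x.toH f ∈ unitBall x.H) ∧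
      ∀ Z : Centered x, (∀ f ∈ F, ∀ hf : x.toH f ∈ unitBall x.H,
        IsLocalRing.residue (unitBall x.H) ⟨x.toH f, hf⟩ ∈ Z.resCenter.range) →
      Function.Surjective Z.resCenter := by
  classical
  let _ := x.resScalar.toAlgebra
  obtain ⟨S, hS⟩ : (⊤ : IntermediateField (ResField k) (ResField x.H)).FG := h
  choose f hf hfy using x.exists_residue_toH_eq
  refine ⟨S.image f, ?_, fun Z hZ => ?_⟩
  · simp only [Finset.mem_image]
    rintro _ ⟨y, -, rfl⟩
    exact hf y
  · let E : IntermediateField (ResField k) (ResField x.H) :=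
      Z.resCenter.fieldRange.toIntermediateField (by
        intro a
        obtain ⟨a, rfl⟩ := IsLocalRing.residue_surjective a
        exact ⟨toResidueField Z.toBase Z.center a,
          congr($(Z.resCenter_comp_toResidueField.trans x.resScalar_comp_residue.symm) a)⟩)
    have hE : E = ⊤ := by
      rw [eq_top_iff, ← hS, IntermediateField.adjoin_le_iff]
      intro y hy
      rw [← hfy y]
      exact hZ (f y) (Finset.mem_image_of_mem f hy) (hf y)
    intro y
    have : y ∈ E := hE ▸ IntermediateField.mem_top
    exact this

/-- Morphisms from `Spec ℋ(x)°` to an affine scheme are determined by their restriction to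
`Spec ℋ(x)`. -/
lemma AnPoint.hom_ext_of_specHToBall {A : CommRingCat.{u}}
    {f g : Spec (.of (unitBall x.H)) ⟶ Spec A}
    (h : x.specHToBall ≫ f = x.specHToBall ≫ g) : f = g := by
  obtain ⟨f, rfl⟩ := Spec.map_surjective f
  obtain ⟨g, rfl⟩ := Spec.map_surjective g
  rw [specHToBall, ← Spec.map_comp, ← Spec.map_comp] at h
  congr 1
  ext a
  exact congr($(Spec.map_injective h) a)

/-- The inclusion `κ(pt) → ℋ(x)` as a morphism of `CommRingCat`. -/
noncomputable def AnPoint.toHHom (x : AnPoint s) : X.residueField x.pt ⟶ .of x.H :=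
  ConcreteCategory.ofHom (C := CommRingCat) (X := X.residueField x.pt) (Y := .of x.H) x.toH

omit [IsUltrametricDist k] in
lemma AnPoint.specHToPt_eq (x : AnPoint s) : x.specHToPt = Spec.map x.toHHom := rfl

lemma AnPoint.specHToBall_specBallToBase (x : AnPoint s) :
    x.specHToBall ≫ x.specBallToBase =
      x.specHToPt ≫ X.fromSpecResidueField x.pt ≫ s ≫ specToBall k := by
  have : Spec.map (Spec.preimage (X.fromSpecResidueField x.pt ≫ s)) =
    X.fromSpecResidueField x.pt ≫ s := Spec.map_preimage _
  rw [← reassoc_of% this, specHToBall, specBallToBase, specHToPt_eq, specToBall,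
    ← Spec.map_comp, ← Spec.map_comp, ← Spec.map_comp]
  rfl

end Center

/-! ### The valuation ring of the base field -/

section Base

variable {k : Type u} [NormedField k] [IsUltrametricDist k]

lemma exists_norm_lt_one (h : unitBall k ≠ ⊤) : ∃ a : k, a ≠ 0 ∧ ‖a‖ < 1 := by
  obtain ⟨a, ha⟩ : ∃ a : k, a ∉ unitBall k := by
    by_contra! hk
    exact h (eq_top_iff.mpr fun a _ => hk a)
  rw [mem_unitBall, not_le] at ha
  refine ⟨a⁻¹, inv_ne_zero fun h0 => ?_, ?_⟩
  · rw [h0, norm_zero] at ha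
    exact absurd ha (by norm_num)
  · rw [norm_inv]
    exact inv_lt_one_of_one_lt₀ ha

omit [IsUltrametricDist k] in
lemma exists_norm_pow_mul_le_one {a : k} (ha : ‖a‖ < 1) (c : ℝ) :
    ∃ n : ℕ, ‖a‖ ^ n * c ≤ 1 := by
  have h := (tendsto_pow_atTop_nhds_zero_of_lt_one (norm_nonneg a) ha).mul_const c
  rw [zero_mul] at h
  obtain ⟨n, hn⟩ := (h.eventually (ge_mem_nhds one_pos)).exists
  exact ⟨n, hn⟩

lemma isLocalization_away_unitBall {a : unitBall k} (ha0 : a ≠ 0) (ha : ‖(a : k)‖ < 1) :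
    IsLocalization.Away a k := by
  have ha0' : (a : k) ≠ 0 := fun h => ha0 (Subtype.ext h)
  refine IsLocalization.Away.mk _ ?_ ?_ ?_
  · exact isUnit_iff_ne_zero.mpr ha0'
  · intro c
    obtain ⟨n, hn⟩ := exists_norm_pow_mul_le_one ha ‖c‖
    refine ⟨n, ⟨c * (a : k) ^ n, ?_⟩, ?_⟩
    · rw [mem_unitBall, norm_mul, norm_pow, mul_comm]
      exact hn
    · simp
  · intro b c h
    exact ⟨0, by simpa using h⟩

end Base

/-! ### Gluing two schemes along a common open subscheme -/

section Gluing

open Limits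

/-- A morphism is separated if every two points of the source in one fibre lie in a common open
subscheme that is separated over the target. -/
lemma isSeparated_of_forall_exists_mem_range {Z S : Scheme.{u}} (f : Z ⟶ S) {ι : Type*}
    {Y : ι → Scheme.{u}} (g : ∀ i, Y i ⟶ Z) [∀ i, IsOpenImmersion (g i)]
    [∀ i, IsSeparated (g i ≫ f)]
    (h : ∀ z z' : Z, f z = f z' → ∃ i, z ∈ Set.range (g i) ∧ z' ∈ Set.range (g i)) :
    IsSeparated f := by
  refine ⟨IsClosedImmersion.of_isPreimmersion _ ?_⟩
  rw [← isOpen_compl_iff, isOpen_iff_forall_mem_open]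
  intro p hp
  obtain ⟨i, hi⟩ := h (pullback.fst f f p) (pullback.snd f f p) (by
    rw [← Scheme.Hom.comp_apply, ← Scheme.Hom.comp_apply, pullback.condition])
  let G : pullback (g i ≫ f) (g i ≫ f) ⟶ pullback f f :=
    pullback.map _ _ _ _ (g i) (g i) (𝟙 S) (by simp) (by simp)
  have hG : pullback.diagonal (g i ≫ f) ≫ G = g i ≫ pullback.diagonal f := by
    have h1 : G ≫ pullback.fst f f = pullback.fst (g i ≫ f) (g i ≫ f) ≫ g i :=
      pullback.lift_fst _ _ _
    have h2 : G ≫ pullback.snd f f = pullback.snd (g i ≫ f) (g i ≫ f) ≫ g i :=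
      pullback.lift_snd _ _ _
    apply pullback.hom_ext
    · rw [Category.assoc, Category.assoc, h1, pullback.diagonal_fst, pullback.diagonal_fst_assoc,
        Category.comp_id]
    · rw [Category.assoc, Category.assoc, h2, pullback.diagonal_snd, pullback.diagonal_snd_assoc,
        Category.comp_id]
  have hGo : IsOpenImmersion G := inferInstance
  obtain ⟨q, rfl⟩ : p ∈ Set.range G := by
    rw [Scheme.Pullback.range_map]
    exact hi
  refine ⟨G '' (Set.range (pullback.diagonal (g i ≫ f)))ᶜ, ?_, ?_, ?_⟩
  · rintro _ ⟨q', hq', rfl⟩ ⟨z, hz⟩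
    obtain ⟨y, rfl⟩ : z ∈ Set.range (g i) := by
      refine ⟨pullback.fst (g i ≫ f) (g i ≫ f) q', ?_⟩
      have := congr(pullback.fst f f $hz)
      rw [← Scheme.Hom.comp_apply, ← Scheme.Hom.comp_apply, pullback.diagonal_fst] at this
      simpa [G, pullback.lift_fst] using this.symm
    apply hq'
    refine ⟨y, G.isOpenEmbedding.injective ?_⟩
    rw [← hz, ← Scheme.Hom.comp_apply, ← Scheme.Hom.comp_apply, hG]
  · exact G.isOpenEmbedding.isOpenMap _
      (pullback.diagonal (g i ≫ f)).isClosedEmbedding.isClosed_range.isOpen_compl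
  · refine ⟨q, ?_, rfl⟩
    rintro ⟨y, rfl⟩
    apply hp
    exact ⟨g i y, by rw [← Scheme.Hom.comp_apply, ← Scheme.Hom.comp_apply, hG]⟩

variable {W X V S : Scheme.{u}} (a : W ⟶ X) (b : W ⟶ V) [IsOpenImmersion a] [IsOpenImmersion b]

instance : IsOpenImmersion (pushout.inl a b) :=
  inferInstanceAs (IsOpenImmersion (colimit.ι (span a b) _))

instance : IsOpenImmersion (pushout.inr a b) :=
  inferInstanceAs (IsOpenImmersion (colimit.ι (span a b) _))

lemma mem_range_inl_or_mem_range_inr (z : (pushout a b : Scheme.{u})) :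
    z ∈ Set.range (pushout.inl a b) ∨ z ∈ Set.range (pushout.inr a b) := by
  obtain ⟨i, y, rfl⟩ := Scheme.IsLocallyDirected.ι_jointly_surjective (span a b) z
  obtain (_ | _ | _) := i
  · refine Or.inl ⟨a y, ?_⟩
    exact congr($(colimit.w (span a b) WalkingSpan.Hom.fst) y)
  · exact Or.inl ⟨y, rfl⟩
  · exact Or.inr ⟨y, rfl⟩

/-- The cover of the glued scheme by its two pieces. -/
noncomputable def pushoutCover : (pushout a b : Scheme.{u}).OpenCover :=
  Scheme.openCoverOfIsOpenCover _
    (fun i : Bool => cond i (pushout.inl a b).opensRange (pushout.inr a b).opensRange) <| by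
      rw [TopologicalSpace.IsOpenCover, eq_top_iff]
      intro z _
      rw [TopologicalSpace.Opens.mem_iSup]
      exact (mem_range_inl_or_mem_range_inr a b z).elim (fun h => ⟨true, h⟩) fun h => ⟨false, h⟩

variable {a b}

lemma of_inl_of_inr {P : MorphismProperty Scheme.{u}} [IsZariskiLocalAtSource P]
    {t : pushout a b ⟶ S} (h1 : P (pushout.inl a b ≫ t)) (h2 : P (pushout.inr a b ≫ t)) :
    P t := by
  have key : ∀ {Y : Scheme.{u}} (f : Y ⟶ pushout a b) [IsOpenImmersion f], P (f ≫ t) →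
      P (f.opensRange.ι ≫ t) := fun f _ hf => by
    rwa [← P.cancel_left_of_respectsIso f.isoOpensRange.hom, ← Category.assoc,
      Scheme.Hom.isoOpensRange_hom_ι]
  refine IsZariskiLocalAtSource.of_openCover (pushoutCover a b) ?_
  rintro (_ | _)
  · exact key _ h2
  · exact key _ h1

variable (a b)

lemma isIntegral_pushout [IsIntegral X] [IsIntegral V] [Nonempty W] :
    IsIntegral (pushout a b : Scheme.{u}) := by
  have hred : IsReduced (pushout a b : Scheme.{u}) := by
    have key : ∀ {Y : Scheme.{u}} [IsIntegral Y] (f : Y ⟶ pushout a b) [IsOpenImmersion f] (y : Y),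
        _root_.IsReduced ((pushout a b : Scheme.{u}).presheaf.stalk (f y)) := fun f _ y =>
      isReduced_of_injective (f.stalkMap y).hom
        (ConcreteCategory.bijective_of_isIso (f.stalkMap y)).1
    have : ∀ z : (pushout a b : Scheme.{u}),
        _root_.IsReduced ((pushout a b : Scheme.{u}).presheaf.stalk z) := by
      intro z
      obtain (⟨y, rfl⟩ | ⟨y, rfl⟩) := mem_range_inl_or_mem_range_inr a b z
      · exact key _ y
      · exact key _ y
    exact isReduced_of_isReduced_stalk _
  have hdense : closure (Set.range (pushout.inl a b)) = Set.univ := by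
    refine Set.eq_univ_of_univ_subset fun z _ => ?_
    obtain (h | ⟨v, rfl⟩) := mem_range_inl_or_mem_range_inr a b z
    · exact subset_closure h
    · rw [mem_closure_iff]
      intro O hO hvO
      obtain ⟨w₀⟩ := ‹Nonempty W›
      obtain ⟨v', hv', w, rfl⟩ := nonempty_preirreducible_inter
        (hO.preimage (pushout.inr a b).continuous) b.isOpenEmbedding.isOpen_range
        ⟨v, hvO⟩ ⟨b w₀, w₀, rfl⟩
      refine ⟨_, hv', a w, ?_⟩
      rw [← Scheme.Hom.comp_apply, ← Scheme.Hom.comp_apply, pushout.condition]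
  have hirr : IsIrreducible (Set.univ : Set (pushout a b : Scheme.{u})) := by
    rw [← hdense, ← Set.image_univ]
    exact ((IrreducibleSpace.isIrreducible_univ X).image _
      (pushout.inl a b).continuous.continuousOn).closure
  have : IrreducibleSpace (pushout a b : Scheme.{u}) :=
    irreducibleSpace_def _ |>.mpr hirr
  exact isIntegral_of_irreducibleSpace_of_isReduced _

instance [CompactSpace X] [CompactSpace V] : CompactSpace (pushout a b : Scheme.{u}) := by
  rw [← isCompact_univ_iff]
  convert (isCompact_range (pushout.inl a b).continuous).union
    (isCompact_range (pushout.inr a b).continuous)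
  exact (Set.eq_univ_of_forall (mem_range_inl_or_mem_range_inr a b)).symm

variable {a b} {E : Scheme.{u}} {e : E ⟶ S} [IsOpenImmersion e] {p : X ⟶ E} {q : V ⟶ S}
  (h : a ≫ p ≫ e = b ≫ q) (hb : ∀ v, q v ∈ Set.range e → v ∈ Set.range b)

omit [IsOpenImmersion e] in
include hb in
lemma mem_range_inl_of_desc_mem_range (z : (pushout a b : Scheme.{u}))
    (hz : pushout.desc (p ≫ e) q h z ∈ Set.range e) : z ∈ Set.range (pushout.inl a b) := by
  obtain (h' | ⟨v, rfl⟩) := mem_range_inl_or_mem_range_inr a b z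
  · exact h'
  · rw [← Scheme.Hom.comp_apply, pushout.inr_desc] at hz
    obtain ⟨w, rfl⟩ := hb v hz
    exact ⟨a w, by rw [← Scheme.Hom.comp_apply, ← Scheme.Hom.comp_apply, pushout.condition]⟩

include hb in
/-- If `X` lies over the open subscheme `E` of `S`, and the part of `V` over `E` is identified with
an open subscheme of `X`, then the result of gluing `X` and `V` along that part is `X` over `E`. -/
lemma isPullback_pushout_inl :
    IsPullback (pushout.inl a b) p (pushout.desc (p ≫ e) q h) e := by
  refine (IsOpenImmersion.isPullback p (pushout.inl a b) e _
    (pushout.inl_desc _ _ _) ?_).flip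
  ext z
  refine ⟨mem_range_inl_of_desc_mem_range h hb z, ?_⟩
  rintro ⟨y, rfl⟩
  refine ⟨p y, ?_⟩
  rw [← Scheme.Hom.comp_apply, ← Scheme.Hom.comp_apply, pushout.inl_desc]

include hb in
lemma isSeparated_pushout_desc [IsSeparated p] [IsSeparated q] :
    IsSeparated (pushout.desc (p ≫ e) q h) := by
  let Y : Bool → Scheme.{u} := fun i => cond i X V
  let g : ∀ i, Y i ⟶ pushout a b := fun i => match i with
    | true => pushout.inl a b
    | false => pushout.inr a b
  have : ∀ i, IsOpenImmersion (g i) := by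
    rintro (_ | _)
    · exact inferInstanceAs (IsOpenImmersion (pushout.inr a b))
    · exact inferInstanceAs (IsOpenImmersion (pushout.inl a b))
  have : ∀ i, IsSeparated (g i ≫ pushout.desc (p ≫ e) q h) := by
    rintro (_ | _)
    · change IsSeparated (pushout.inr a b ≫ pushout.desc (p ≫ e) q h)
      rw [pushout.inr_desc]
      infer_instance
    · change IsSeparated (pushout.inl a b ≫ pushout.desc (p ≫ e) q h)
      rw [pushout.inl_desc]
      infer_instance
  refine isSeparated_of_forall_exists_mem_range _ g fun z z' hz => ?_
  by_cases hE : pushout.desc (p ≫ e) q h z ∈ Set.range e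
  · exact ⟨true, mem_range_inl_of_desc_mem_range h hb z hE,
      mem_range_inl_of_desc_mem_range h hb z' (hz ▸ hE)⟩
  · have key : ∀ z, pushout.desc (p ≫ e) q h z ∉ Set.range e → z ∈ Set.range (pushout.inr a b) := by
      intro z hz
      refine (mem_range_inl_or_mem_range_inr a b z).resolve_left ?_
      rintro ⟨y, rfl⟩
      rw [← Scheme.Hom.comp_apply, pushout.inl_desc] at hz
      exact hz ⟨p y, by rw [← Scheme.Hom.comp_apply]⟩
    exact ⟨false, key z hE, key z' (hz ▸ hE)⟩

end Gluing

/-! ### Models over a nontrivially valued field -/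

section Subalgebra

variable {k : Type u} [NormedField k] [IsUltrametricDist k] {R : Type u} [CommRing R]
  [Algebra k R] [Algebra (unitBall k) R] [IsScalarTower (unitBall k) k R]

/-- A `k°`-subalgebra of `R` generated by generators of `R` over `k` becomes `R` when some
`a ∈ k°` with `0 < ‖a‖ < 1` is inverted. -/
lemma isLocalization_away_adjoin {a : unitBall k} (ha0 : a ≠ 0) (ha : ‖(a : k)‖ < 1) {T : Set R}
    (hT : Algebra.adjoin k T = ⊤) :
    IsLocalization.Away (algebraMap (unitBall k) (Algebra.adjoin (unitBall k) T) a) R := by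
  have ha0' : (a : k) ≠ 0 := fun h => ha0 (Subtype.ext h)
  have hak : algebraMap (unitBall k) R a = algebraMap k R a :=
    IsScalarTower.algebraMap_apply (unitBall k) k R a
  have haA : ∀ n : ℕ, algebraMap (unitBall k) R a ^ n ∈ Algebra.adjoin (unitBall k) T :=
    fun n => pow_mem (Subalgebra.algebraMap_mem _ a) n
  refine IsLocalization.Away.mk _ ?_ ?_ ?_
  · change IsUnit (algebraMap (unitBall k) R a)
    rw [hak]
    exact (isUnit_iff_ne_zero.mpr ha0').map (algebraMap k R)
  · intro r
    suffices h : ∃ n : ℕ, r * algebraMap (unitBall k) R a ^ n ∈ Algebra.adjoin (unitBall k) T by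
      obtain ⟨n, hn⟩ := h
      exact ⟨n, ⟨_, hn⟩, rfl⟩
    have hr : r ∈ Algebra.adjoin k T := hT ▸ Algebra.mem_top
    induction hr using Algebra.adjoin_induction with
    | mem t ht => exact ⟨0, by simpa using Algebra.subset_adjoin ht⟩
    | algebraMap c =>
      obtain ⟨n, hn⟩ := exists_norm_pow_mul_le_one ha ‖c‖
      refine ⟨n, ?_⟩
      have hc : c * (a : k) ^ n ∈ unitBall k := by
        rw [mem_unitBall, norm_mul, norm_pow, mul_comm]
        exact hn
      have : algebraMap k R c * algebraMap (unitBall k) R a ^ n =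
          algebraMap (unitBall k) R ⟨_, hc⟩ := by
        rw [hak, ← map_pow, ← map_mul, IsScalarTower.algebraMap_apply (unitBall k) k R ⟨_, hc⟩]
        rfl
      rw [this]
      exact Subalgebra.algebraMap_mem _ _
    | add r r' _ _ hr hr' =>
      obtain ⟨n, hn⟩ := hr
      obtain ⟨m, hm⟩ := hr'
      refine ⟨n + m, ?_⟩
      convert add_mem (mul_mem hn (haA m)) (mul_mem hm (haA n)) using 1
      ring
    | mul r r' _ _ hr hr' =>
      obtain ⟨n, hn⟩ := hr
      obtain ⟨m, hm⟩ := hr'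
      refine ⟨n + m, ?_⟩
      convert mul_mem hn hm using 1
      ring
  · intro b c h
    exact ⟨0, by simpa using Subtype.ext h⟩

omit [Algebra (unitBall k) R] [IsScalarTower (unitBall k) k R] in
/-- Generators of a `k`-algebra can be scaled so that they lie in the unit ball of a given
multiplicative seminorm. -/
lemma exists_finset_adjoin_eq_top [Algebra.FiniteType k R] (hk : unitBall k ≠ ⊤) {L : Type u}
    [NormedField L] (P : R →+* L) (hP : ∀ c : k, ‖P (algebraMap k R c)‖ = ‖c‖) (F : Finset R)
    (hF : ∀ f ∈ F, ‖P f‖ ≤ 1) :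
    ∃ T : Finset R, F ⊆ T ∧ (∀ t ∈ T, ‖P t‖ ≤ 1) ∧ Algebra.adjoin k (T : Set R) = ⊤ := by
  classical
  obtain ⟨a, ha0, ha⟩ := exists_norm_lt_one hk
  obtain ⟨G, hG⟩ := ‹Algebra.FiniteType k R›
  choose n hn using fun g : R => exists_norm_pow_mul_le_one ha ‖P g‖
  refine ⟨F ∪ G.image fun g => algebraMap k R a ^ n g * g, Finset.subset_union_left, ?_, ?_⟩
  · intro t ht
    obtain ht | ht := Finset.mem_union.mp ht
    · exact hF t ht
    · obtain ⟨g, -, rfl⟩ := Finset.mem_image.mp ht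
      rw [map_mul, map_pow, norm_mul, norm_pow, hP]
      exact hn g
  · rw [eq_top_iff, ← hG, Algebra.adjoin_le_iff]
    intro g hg
    have h1 : algebraMap k R a ^ n g * g ∈ Algebra.adjoin k
        ((F ∪ G.image fun g => algebraMap k R a ^ n g * g : Finset R) : Set R) :=
      Algebra.subset_adjoin (Finset.mem_coe.mpr
        (Finset.mem_union_right _ (Finset.mem_image_of_mem _ hg)))
    have h2 := mul_mem (Subalgebra.algebraMap_mem (Algebra.adjoin k
        ((F ∪ G.image fun g => algebraMap k R a ^ n g * g : Finset R) : Set R))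
        ((a ^ n g)⁻¹)) h1
    rwa [← mul_assoc, ← map_pow, ← map_mul, inv_mul_cancel₀ (pow_ne_zero _ ha0), map_one,
      one_mul] at h2

lemma norm_le_one_of_mem_adjoin {L : Type u} [NormedField L] [IsUltrametricDist L] (P : R →+* L)
    (hP : ∀ c : k, ‖P (algebraMap k R c)‖ = ‖c‖) {T : Set R} (hT : ∀ t ∈ T, ‖P t‖ ≤ 1) {r : R}
    (hr : r ∈ Algebra.adjoin (unitBall k) T) : P r ∈ unitBall L := by
  induction hr using Algebra.adjoin_induction with
  | mem t ht => exact hT t ht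
  | algebraMap c =>
    rw [mem_unitBall, IsScalarTower.algebraMap_apply (unitBall k) k R, hP]
    exact c.2
  | add r r' _ _ hr hr' => rw [map_add]; exact add_mem hr hr'
  | mul r r' _ _ hr hr' => rw [map_mul]; exact mul_mem hr hr'

lemma flat_of_injective {V A : Type*} [CommRing V] [IsDomain V] [ValuationRing V] [CommRing A]
    [IsDomain A] [Algebra V A] (h : Function.Injective (algebraMap V A)) : Module.Flat V A := by
  rw [Module.Flat.flat_iff_torsion_eq_bot_of_isBezout, ← Submodule.isTorsionFree_iff_torsion_eq_bot]
  have := (faithfulSMul_iff_algebraMap_injective V A).mpr h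
  infer_instance

end Subalgebra

section Base

variable {k : Type u} [NormedField k] [IsUltrametricDist k]

lemma range_specToBall {a : unitBall k} (ha0 : a ≠ 0) (ha : ‖(a : k)‖ < 1) :
    Set.range (specToBall k) = (PrimeSpectrum.basicOpen a : Set (PrimeSpectrum (unitBall k))) :=
  have := isLocalization_away_unitBall ha0 ha
  PrimeSpectrum.localization_away_comap_range k a

lemma isOpenImmersion_specToBall (hk : unitBall k ≠ ⊤) : IsOpenImmersion (specToBall k) := by
  obtain ⟨a, ha0, ha⟩ := exists_norm_lt_one hk
  have := isLocalization_away_unitBall (a := ⟨a, ha.le⟩) (fun h => ha0 congr(($h : k))) ha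
  exact IsOpenImmersion.of_isLocalization (R := unitBall k) (S := k) ⟨a, ha.le⟩

instance : LocallyOfFiniteType (specToBall k) := by
  by_cases hk : unitBall k = ⊤
  · rw [specToBall, HasRingHomProperty.Spec_iff (P := @LocallyOfFiniteType)]
    exact RingHom.FiniteType.of_surjective _ fun c => ⟨⟨c, hk ▸ ValuationSubring.mem_top c⟩, rfl⟩
  · have := isOpenImmersion_specToBall hk
    infer_instance

end Base

/-- Finitely many elements of a residue field of a scheme are values of functions on a suitable
affine open neighbourhood. -/
lemma exists_isAffineOpen_forall_mem_range {X : Scheme.{u}} (p : X)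
    (F : Finset (X.residueField p)) :
    ∃ (W : X.Opens) (_ : IsAffineOpen W) (hp : p ∈ W),
      ∀ f ∈ F, f ∈ Set.range (X.evaluation W p hp) := by
  classical
  induction F using Finset.induction_on with
  | empty =>
    obtain ⟨_, ⟨W, hW, rfl⟩, hp, -⟩ := X.isBasis_affineOpens.exists_subset_of_mem_open
      (Set.mem_univ p) isOpen_univ
    exact ⟨W, hW, hp, by simp⟩
  | insert f F _ ih =>
    obtain ⟨W₀, -, hp₀, hF⟩ := ih
    obtain ⟨g, rfl⟩ := X.residue_surjective p f
    obtain ⟨U, hpU, g, rfl⟩ := X.presheaf.exists_germ_eq g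
    obtain ⟨_, ⟨W, hW, rfl⟩, hp, hWU⟩ := X.isBasis_affineOpens.exists_subset_of_mem_open
      (show p ∈ ((W₀ ⊓ U : X.Opens) : Set X) from ⟨hp₀, hpU⟩) (W₀ ⊓ U).isOpen
    have key : ∀ {U : X.Opens} (i : W ≤ U) (g : Γ(X, U)), X.evaluation U p (i hp) g ∈
        Set.range (X.evaluation W p hp) := fun i g => by
      refine ⟨X.presheaf.map (homOfLE i).op g, ?_⟩
      simp only [Scheme.evaluation, CommRingCat.comp_apply]
      rw [TopCat.Presheaf.germ_res_apply]
    refine ⟨W, hW, hp, fun f hf => ?_⟩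
    obtain rfl | hf := Finset.mem_insert.mp hf
    · exact key (fun y hy => (hWU hy).2) g
    · obtain ⟨g, rfl⟩ := hF f hf
      exact key (fun y hy => (hWU hy).1) g

section Model

open Limits

variable {k : Type u} [NormedField k] [IsUltrametricDist k]
  {X : Scheme.{u}} {s : X ⟶ Spec (.of k)}

lemma isModel_pushout_inl [IsIntegral X] [IsSeparated s] [LocallyOfFiniteType s] [QuasiCompact s]
    (hk : unitBall k ≠ ⊤) {W V : Scheme.{u}} (a : W ⟶ X) (b : W ⟶ V) [IsOpenImmersion a]
    [IsOpenImmersion b] [Nonempty W] {q : V ⟶ Spec (.of (unitBall k))} [IsIntegral V] [IsAffine V]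
    [Flat q] [LocallyOfFiniteType q] (h : a ≫ s ≫ specToBall k = b ≫ q)
    (hb : ∀ v, q v ∈ Set.range (specToBall k) → v ∈ Set.range b) :
    IsModel s (pushout.desc (s ≫ specToBall k) q h) (pushout.inl a b) := by
  have := isOpenImmersion_specToBall hk
  have : CompactSpace X := (quasiCompact_iff_compactSpace s).mp inferInstance
  have : IsZariskiLocalAtSource @Flat := HasRingHomProperty.instIsZariskiLocalAtSource (P := @Flat)
  have : IsZariskiLocalAtSource @LocallyOfFiniteType :=
    HasRingHomProperty.instIsZariskiLocalAtSource (P := @LocallyOfFiniteType)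
  exact
    { isIntegral := isIntegral_pushout a b
      flat := of_inl_of_inr (P := @Flat) (by rw [pushout.inl_desc]; infer_instance)
        (by rw [pushout.inr_desc]; infer_instance)
      locallyOfFiniteType := of_inl_of_inr (P := @LocallyOfFiniteType)
        (by rw [pushout.inl_desc]; infer_instance) (by rw [pushout.inr_desc]; infer_instance)
      quasiCompact := (quasiCompact_iff_compactSpace _).mpr inferInstance
      isSeparated := isSeparated_pushout_desc h hb
      isPullback := isPullback_pushout_inl h hb }

/-- Over a nontrivially valued field, any finite set of elements of the function field of norm at
most one consists of functions defined at the center of `x` in a suitable model. -/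
lemma exists_isModelOf_forall_residue_mem_range [IsIntegral X] [IsSeparated s]
    [LocallyOfFiniteType s] [QuasiCompact s] (hk : unitBall k ≠ ⊤) (x : AnPoint s)
    (F : Finset (X.residueField x.pt)) (hF : ∀ f ∈ F, x.toH f ∈ unitBall x.H) :
    ∃ Z : Centered x, Z.IsModelOf ∧ ∀ f ∈ F, ∀ hf : x.toH f ∈ unitBall x.H,
      IsLocalRing.residue (unitBall x.H) ⟨x.toH f, hf⟩ ∈ Z.resCenter.range := by
  classical
  obtain ⟨W, hW, hp, hFW⟩ := exists_isAffineOpen_forall_mem_range x.pt F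
  have := hW.isOpenImmersion_fromSpec
  have : Nonempty W := ⟨⟨_, hp⟩⟩
  let ι : CommRingCat.of k ⟶ Γ(X, W) := Spec.preimage (hW.fromSpec ≫ s)
  have hι : Spec.map ι = hW.fromSpec ≫ s := Spec.map_preimage _
  let _ : Algebra k Γ(X, W) := ι.hom.toAlgebra
  let _ : Algebra (unitBall k) Γ(X, W) := (ι.hom.comp (unitBall k).subtype).toAlgebra
  have : IsScalarTower (unitBall k) k Γ(X, W) := .of_algebraMap_eq fun _ => rfl
  have : Algebra.FiniteType k Γ(X, W) := by
    have : ι.hom.FiniteType := by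
      rw [← HasRingHomProperty.Spec_iff (P := @LocallyOfFiniteType), hι]
      infer_instance
    exact this
  let P : Γ(X, W) ⟶ .of x.H := X.evaluation W x.pt hp ≫ x.toHHom
  have hιs : ι ≫ X.evaluation W x.pt hp = Spec.preimage (X.fromSpecResidueField x.pt ≫ s) := by
    apply Spec.map_injective
    rw [Spec.map_preimage, Spec.map_comp, hι, ← Category.assoc, map_evaluation_fromSpec hW]
  have hιP : ι ≫ P = CommRingCat.ofHom x.scalarH := by
    rw [← Category.assoc, hιs]
    rfl
  have hP : ∀ c : k, ‖P.hom (algebraMap k Γ(X, W) c)‖ = ‖c‖ := fun c => by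
    rw [← x.norm_scalarH c]
    exact congr(‖$hιP c‖)
  choose! g hg using hFW
  obtain ⟨T, hFT, hT1, hT⟩ := exists_finset_adjoin_eq_top hk P.hom hP (F.image g) (by
    intro r hr
    obtain ⟨f, hf, rfl⟩ := Finset.mem_image.mp hr
    have : P.hom (g f) = x.toH f := congrArg x.toH (hg f hf)
    rw [this]
    exact hF f hf)
  let A := Algebra.adjoin (unitBall k) (T : Set Γ(X, W))
  have : Algebra.FiniteType (unitBall k) A := .adjoin_of_finite T.finite_toSet
  have hinj : Function.Injective (algebraMap (unitBall k) A) := by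
    have h1 : Function.Injective (algebraMap k Γ(X, W)) := RingHom.injective _
    intro c c' h
    exact Subtype.ext (h1 congr(($h : Γ(X, W))))
  have : Module.Flat (unitBall k) A := flat_of_injective hinj
  let φ : CommRingCat.of A ⟶ .of (unitBall x.H) := CommRingCat.ofHom
    ((P.hom.comp A.val.toRingHom).codRestrict (unitBall x.H).toSubring fun r =>
      norm_le_one_of_mem_adjoin P.hom hP hT1 r.2)
  let b : Spec Γ(X, W) ⟶ Spec (.of A) := Spec.map (CommRingCat.ofHom A.val.toRingHom)
  let q : Spec (.of A) ⟶ Spec (.of (unitBall k)) :=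
    Spec.map (CommRingCat.ofHom (algebraMap (unitBall k) A))
  obtain ⟨c, hc0, hc⟩ := exists_norm_lt_one hk
  obtain ⟨c, rfl⟩ : ∃ c' : unitBall k, (c' : k) = c := ⟨⟨c, hc.le⟩, rfl⟩
  have hc0 : c ≠ 0 := fun h => hc0 congr(($h : k))
  have hloc := isLocalization_away_adjoin hc0 hc hT
  have : IsOpenImmersion b := IsOpenImmersion.of_isLocalization (algebraMap (unitBall k) A c)
  have : Flat q := by
    rw [Flat.SpecMap_iff]
    exact RingHom.flat_algebraMap_iff.mpr inferInstance
  have : LocallyOfFiniteType q := by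
    rw [HasRingHomProperty.Spec_iff (P := @LocallyOfFiniteType)]
    exact RingHom.finiteType_algebraMap.mpr inferInstance
  have h : hW.fromSpec ≫ s ≫ specToBall k = b ≫ q := by
    rw [← Category.assoc, ← hι, specToBall, ← Spec.map_comp, ← Spec.map_comp]
    rfl
  have hb : ∀ v, q v ∈ Set.range (specToBall k) → v ∈ Set.range b := by
    intro v hv
    rw [range_specToBall hc0 hc] at hv
    have := PrimeSpectrum.localization_away_comap_range Γ(X, W) (algebraMap (unitBall k) A c)
    exact this.ge hv
  let Z : Centered x := {
    scheme := pushout hW.fromSpec b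
    toBase := pushout.desc (s ≫ specToBall k) q h
    fromPt := X.fromSpecResidueField x.pt ≫ pushout.inl _ _
    lift := Spec.map φ ≫ pushout.inr _ _
    specHToBall_lift := by
      rw [x.specHToPt_eq, ← map_evaluation_fromSpec hW _ hp, Category.assoc,
        pushout.condition]
      simp only [← Category.assoc]
      congr 1
      simp only [AnPoint.specHToBall, b, ← Spec.map_comp]
      rfl
    lift_toBase := by
      rw [Category.assoc, pushout.inr_desc, AnPoint.specBallToBase, ← Spec.map_comp]
      congr 1
      ext r
      exact congr($hιP r) }
  refine ⟨Z, ⟨pushout.inl _ _, isModel_pushout_inl hk _ _ h hb, rfl⟩, fun f hf hf' => ?_⟩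
  have : IsOpenImmersion (Y := Z.scheme) (pushout.inr hW.fromSpec b) :=
    inferInstanceAs (IsOpenImmersion (pushout.inr hW.fromSpec b))
  convert Z.residue_mem_range_resCenter (pushout.inr hW.fromSpec b) φ rfl
    ⟨g f, Algebra.subset_adjoin (hFT (Finset.mem_image_of_mem g hf))⟩
  exact (congrArg x.toH (hg f hf)).symm

end Model

noncomputable section

/-! ### Charts of the blow-up of an affine scheme -/

section Chart

open HomogeneousLocalization Pointwise

variable {R : Type u} [CommRing R] {I : Ideal R}

/-- The element `r * t ^ n` of the Rees algebra. -/
def reesMonomial (I : Ideal R) (n : ℕ) (r : R) (hr : r ∈ I ^ n) : reesAlgebra I :=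
  ⟨Polynomial.monomial n r, reesAlgebra.monomial_mem.mpr hr⟩

lemma reesMonomial_mem {n : ℕ} {r : R} (hr : r ∈ I ^ n) :
    reesMonomial I n r hr ∈ reesGrading I n :=
  ⟨r, rfl⟩

lemma exists_eq_reesMonomial {n : ℕ} {f : reesAlgebra I} (hf : f ∈ reesGrading I n) :
    ∃ r hr, f = reesMonomial I n r hr := by
  obtain ⟨r, hr⟩ := hf
  have h : Polynomial.monomial n r ∈ reesAlgebra I := by
    have := f.2
    rwa [show (f : Polynomial R) = _ from hr.symm] at this
  exact ⟨r, reesAlgebra.monomial_mem.mp h, Subtype.ext hr.symm⟩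

lemma reesMonomial_mul {m n : ℕ} {r s : R} (hr : r ∈ I ^ m) (hs : s ∈ I ^ n) :
    reesMonomial I m r hr * reesMonomial I n s hs =
      reesMonomial I (m + n) (r * s) (pow_add I m n ▸ Ideal.mul_mem_mul hr hs) :=
  Subtype.ext (Polynomial.monomial_mul_monomial ..)

lemma reesMonomial_pow {m : ℕ} {r : R} (hr : r ∈ I ^ m) (n : ℕ) :
    reesMonomial I m r hr ^ n =
      reesMonomial I (m * n) (r ^ n) (pow_mul I m n ▸ Ideal.pow_mem_pow hr n) :=
  Subtype.ext (by simp [reesMonomial])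

/-- The element `a * t` of the Rees algebra. -/
abbrev reesGen (a : I) : reesAlgebra I :=
  reesMonomial I 1 a ((pow_one I).symm ▸ a.2)

lemma reesGen_mem (a : I) : reesGen a ∈ reesGrading I 1 := reesMonomial_mem _

lemma irrelevant_le_span_reesGen {ι : Type*} (b : ι → I)
    (hb : I ≤ Ideal.span (Set.range fun i => (b i : R))) :
    (HomogeneousIdeal.irrelevant (reesGrading I)).toIdeal ≤
      Ideal.span (Set.range fun i => reesGen (b i)) := by
  rw [HomogeneousIdeal.toIdeal_irrelevant_le]
  intro n hn f hf
  obtain ⟨r, hr, rfl⟩ := exists_eq_reesMonomial hf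
  obtain ⟨n, rfl⟩ := Nat.exists_eq_succ_of_ne_zero hn.ne'
  change _ ∈ Ideal.span _
  -- the coefficient is a combination of products of elements of `I ^ n` and generators
  have key : ∀ r ∈ I ^ n * Ideal.span (Set.range fun i => (b i : R)), ∃ h : r ∈ I ^ (n + 1),
      reesMonomial I (n + 1) r h ∈ Ideal.span (Set.range fun i => reesGen (b i)) := by
    intro r hr
    rw [← Ideal.span_eq (I ^ n), Ideal.span_mul_span'] at hr
    induction hr using Submodule.span_induction with
    | mem x hx =>
      obtain ⟨g, hg, _, ⟨i, rfl⟩, rfl⟩ := hx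
      have := Ideal.mul_mem_left (Ideal.span (Set.range fun i => reesGen (b i)))
        (reesMonomial I n g hg) (Ideal.subset_span ⟨i, rfl⟩)
      rw [reesMonomial_mul] at this
      exact ⟨_, this⟩
    | zero =>
      refine ⟨zero_mem _, ?_⟩
      convert Ideal.zero_mem _
      exact Subtype.ext (by simp [reesMonomial])
    | add x y hx hy hx' hy' =>
      obtain ⟨hx₁, hx₂⟩ := hx'
      obtain ⟨hy₁, hy₂⟩ := hy'
      refine ⟨add_mem hx₁ hy₁, ?_⟩
      convert Ideal.add_mem _ hx₂ hy₂ using 1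
      exact Subtype.ext (by simp [reesMonomial])
    | smul c x hx hx' =>
      obtain ⟨hx₁, hx₂⟩ := hx'
      refine ⟨Ideal.mul_mem_left _ c hx₁, ?_⟩
      convert Ideal.mul_mem_left _ (algebraMap R _ c) hx₂ using 1
      exact Subtype.ext (by simp [reesMonomial, Polynomial.C_mul_monomial])
  exact (key r (Ideal.mul_mono_right hb (by rwa [← pow_succ]))).2

/-- The coordinate ring of the chart `D₊(a * t)` of the blow-up of `Spec R` along `I`. -/
abbrev BlowUpChart (a : I) : Type u := Away (reesGrading I) (reesGen a)

/-- The structure homomorphism of the chart `D₊(a * t)`. -/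
def toBlowUpChart (a : I) : R →+* BlowUpChart a :=
  (fromZeroRingHom (reesGrading I) _).comp (algebraMap R (reesGrading I 0))

/-- The element `g / a ^ n` of the chart `D₊(a * t)`, for `g` in `I ^ n`. -/
def chartFrac (a : I) (n : ℕ) (g : R) (hg : g ∈ I ^ n) : BlowUpChart a :=
  Away.mk (reesGrading I) (reesGen_mem a) n (reesMonomial I n g hg)
    (by simpa using reesMonomial_mem hg)

variable (a : I)

lemma exists_eq_chartFrac (z : BlowUpChart a) : ∃ n g hg, z = chartFrac a n g hg := by
  obtain ⟨n, f, hf, rfl⟩ := Away.mk_surjective (reesGrading I) (reesGen_mem a) z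
  obtain ⟨r, hr, rfl⟩ := exists_eq_reesMonomial (show f ∈ reesGrading I n by simpa using hf)
  exact ⟨n, r, hr, rfl⟩

lemma val_chartFrac (n : ℕ) (g : R) (hg : g ∈ I ^ n) :
    (chartFrac a n g hg).val =
      Localization.mk (reesMonomial I n g hg)
        (⟨reesGen a ^ n, ⟨n, rfl⟩⟩ : Submonoid.powers (reesGen a)) := rfl

lemma chartFrac_eq_zero_iff (n : ℕ) (g : R) (hg : g ∈ I ^ n) :
    chartFrac a n g hg = 0 ↔ ∃ m, (a : R) ^ m * g = 0 := by
  rw [HomogeneousLocalization.ext_iff_val, val_chartFrac, HomogeneousLocalization.val_zero,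
    Localization.mk_eq_mk', IsLocalization.mk'_eq_zero_iff]
  constructor
  · rintro ⟨⟨_, m, rfl⟩, h⟩
    refine ⟨m, ?_⟩
    have h' : reesGen a ^ m * reesMonomial I n g hg = 0 := h
    rw [reesGen, reesMonomial_pow, reesMonomial_mul] at h'
    exact (Polynomial.monomial_eq_zero_iff _ _).mp congr(($h' : Polynomial R))
  · rintro ⟨m, h⟩
    refine ⟨⟨_, m, rfl⟩, ?_⟩
    change reesGen a ^ m * reesMonomial I n g hg = 0
    rw [reesGen, reesMonomial_pow, reesMonomial_mul]
    exact Subtype.ext ((Polynomial.monomial_eq_zero_iff _ _).mpr h)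

lemma chartFrac_add (n : ℕ) {g h : R} (hg : g ∈ I ^ n) (hh : h ∈ I ^ n) :
    chartFrac a n (g + h) (add_mem hg hh) = chartFrac a n g hg + chartFrac a n h hh := by
  rw [HomogeneousLocalization.ext_iff_val, HomogeneousLocalization.val_add]
  simp only [val_chartFrac, Localization.add_mk_self]
  congr 1
  exact Subtype.ext (by simp [reesMonomial])

lemma chartFrac_mul {m n : ℕ} {g h : R} (hg : g ∈ I ^ m) (hh : h ∈ I ^ n) :
    chartFrac a m g hg * chartFrac a n h hh =
      chartFrac a (m + n) (g * h) (pow_add I m n ▸ Ideal.mul_mem_mul hg hh) := by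
  rw [HomogeneousLocalization.ext_iff_val, HomogeneousLocalization.val_mul]
  simp only [val_chartFrac, Localization.mk_mul, reesMonomial_mul]
  congr 1
  exact Subtype.ext (pow_add _ _ _).symm

lemma toBlowUpChart_apply (r : R) :
    toBlowUpChart a r = chartFrac a 0 r (by simp) := by
  rw [HomogeneousLocalization.ext_iff_val, val_chartFrac]
  rfl

lemma toBlowUpChart_mul_chartFrac (r : R) (n : ℕ) {g : R} (hg : g ∈ I ^ n) :
    toBlowUpChart a r * chartFrac a n g hg =
      chartFrac a n (r * g) (Ideal.mul_mem_left _ _ hg) := by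
  rw [toBlowUpChart_apply, chartFrac_mul]
  congr 1
  simp

lemma chartFrac_self (n : ℕ) :
    chartFrac a n ((a : R) ^ n) (Ideal.pow_mem_pow a.2 n) = 1 := by
  rw [HomogeneousLocalization.ext_iff_val, val_chartFrac, HomogeneousLocalization.val_one]
  convert Localization.mk_self _
  change _ = reesGen a ^ n
  rw [reesGen, reesMonomial_pow]
  exact Subtype.ext (by simp [reesMonomial])

lemma chartFrac_pow_mul (m n : ℕ) {g : R} (hg : g ∈ I ^ n) :
    chartFrac a (m + n) ((a : R) ^ m * g)
      (pow_add I m n ▸ Ideal.mul_mem_mul (Ideal.pow_mem_pow a.2 m) hg) = chartFrac a n g hg := by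
  rw [← chartFrac_mul a (Ideal.pow_mem_pow a.2 m) hg, chartFrac_self]
  exact one_mul (chartFrac a n g hg)

/-- A homomorphism from `R` under which the image of `a` is a unit extends to the chart
`D₊(a * t)`. -/
lemma exists_hom_blowUpChart {K : Type u} [Field K] (ψ : R →+* K) (ha : ψ a ≠ 0) :
    ∃ φ : BlowUpChart a →+* K, ∀ n g hg, φ (chartFrac a n g hg) = ψ g / ψ a ^ n := by
  -- the substitution `t ↦ 1 / a`
  let ev : reesAlgebra I →+* K :=
    (Polynomial.eval₂RingHom ψ (ψ a)⁻¹).comp (reesAlgebra I).val.toRingHom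
  have hev (n : ℕ) (g : R) (hg : g ∈ I ^ n) : ev (reesMonomial I n g hg) = ψ g / ψ a ^ n := by
    change Polynomial.eval₂ ψ (ψ a)⁻¹ (Polynomial.monomial n g) = _
    rw [Polynomial.eval₂_monomial, inv_pow, div_eq_mul_inv]
  have h1 : ev (reesGen a) = 1 := by
    rw [reesGen, hev, pow_one, div_self ha]
  refine ⟨(IsLocalization.Away.lift (S := Localization.Away (reesGen a)) (reesGen a)
    (g := ev) (by rw [h1]; exact isUnit_one)).comp (algebraMap (BlowUpChart a) _), ?_⟩
  intro n g hg
  rw [RingHom.comp_apply, HomogeneousLocalization.algebraMap_apply, val_chartFrac,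
    Localization.mk_eq_mk', IsLocalization.Away.lift, IsLocalization.lift_mk'_spec]
  change _ = ev (reesGen a ^ n) * _
  rw [map_pow, h1, one_pow, one_mul, hev]

end Chart

end

noncomputable section

/-! ### Flat base change of blow-ups -/

section BaseChange

open HomogeneousLocalization HomogeneousIdeal TensorProduct Graded

variable {R S T : Type u} [CommRing R] [CommRing S] [CommRing T] {I : Ideal R} {J : Ideal S}
  {L : Ideal T}

lemma map_mem_pow {φ : R →+* S} (h : I.map φ ≤ J) {n : ℕ} {r : R} (hr : r ∈ I ^ n) :
    φ r ∈ J ^ n :=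
  Ideal.pow_right_mono h n (Ideal.map_pow φ I n ▸ Ideal.mem_map_of_mem φ hr)

/-- The homomorphism of Rees algebras induced by a homomorphism of rings. -/
def reesMap (φ : R →+* S) (h : I.map φ ≤ J) : reesGrading I →+*ᵍ reesGrading J where
  __ := ((Polynomial.mapRingHom φ).comp (reesAlgebra I).val.toRingHom).codRestrict
    (reesAlgebra J) fun f n => by
      change (Polynomial.map φ f).coeff n ∈ J ^ n
      rw [Polynomial.coeff_map]
      exact map_mem_pow h (f.2 n)
  map_mem := by
    rintro n f hf
    obtain ⟨r, hr, rfl⟩ := exists_eq_reesMonomial hf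
    exact ⟨φ r, (Polynomial.map_monomial φ).symm⟩

lemma reesMap_reesMonomial (φ : R →+* S) (h : I.map φ ≤ J) {n : ℕ} {r : R} (hr : r ∈ I ^ n) :
    reesMap φ h (reesMonomial I n r hr) = reesMonomial J n (φ r) (map_mem_pow h hr) :=
  Subtype.ext (Polynomial.map_monomial φ)

/-- The image of an element of `I` in an ideal containing the extension of `I`. -/
def mapGen (φ : R →+* S) (h : I.map φ ≤ J) (a : I) : J := ⟨φ a, h (Ideal.mem_map_of_mem φ a.2)⟩

lemma reesMap_reesGen (φ : R →+* S) (h : I.map φ ≤ J) (a : I) :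
    reesMap φ h (reesGen a) = reesGen (mapGen φ h a) :=
  reesMap_reesMonomial φ h _

lemma reesMap_id : reesMap (RingHom.id R) (J := I) (by simp) = .id _ :=
  GradedRingHom.ext fun _ => Subtype.ext Polynomial.map_id

lemma reesMap_comp (φ : R →+* S) (h : I.map φ ≤ J) (ψ : S →+* T) (h' : J.map ψ ≤ L)
    (h'' : I.map (ψ.comp φ) ≤ L) :
    reesMap (ψ.comp φ) h'' = (reesMap ψ h').comp (reesMap φ h) :=
  GradedRingHom.ext fun f => Subtype.ext (Polynomial.map_map φ ψ f).symm

lemma le_span_range_mapGen (φ : R →+* S) (h : I.map φ = J) :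
    J ≤ Ideal.span (Set.range fun a : I => (mapGen φ h.le a : S)) := by
  conv_lhs => rw [← h, Ideal.map]
  rw [Ideal.span_le]
  rintro _ ⟨r, hr, rfl⟩
  exact Ideal.subset_span ⟨⟨r, hr⟩, rfl⟩

lemma irrelevant_le_map_reesMap (φ : R →+* S) (h : I.map φ = J) :
    irrelevant (reesGrading J) ≤ (irrelevant (reesGrading I)).map (reesMap φ h.le) := by
  change (irrelevant (reesGrading J)).toIdeal ≤ HomogeneousIdeal.toIdeal _
  refine (irrelevant_le_span_reesGen _ (le_span_range_mapGen φ h)).trans ?_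
  rw [Ideal.span_le]
  rintro _ ⟨r, rfl⟩
  change reesGen (mapGen φ h.le r) ∈ _
  rw [← reesMap_reesGen]
  exact Ideal.mem_map_of_mem _
    (HomogeneousIdeal.mem_irrelevant_of_mem _ one_pos (reesGen_mem r))

/-- The morphism of blow-ups induced by a homomorphism of rings `R → S`, where the centre
in `Spec S` is the preimage of the one in `Spec R`. -/
def affineBlowUpMap (φ : R →+* S) (h : I.map φ = J) : affineBlowUp J ⟶ affineBlowUp I :=
  Proj.map (reesMap φ h.le) (irrelevant_le_map_reesMap φ h)

lemma powers_reesGen_le (φ : R →+* S) (h : I.map φ ≤ J) (a : I) :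
    Submonoid.powers (reesGen a) ≤
      (Submonoid.powers (reesGen (mapGen φ h a))).comap (reesMap φ h) := by
  rintro _ ⟨n, rfl⟩
  exact ⟨n, by simp [reesMap_reesGen]⟩

/-- The homomorphism of charts `D₊(a * t)` induced by a homomorphism of rings. -/
def blowUpChartMap (φ : R →+* S) (h : I.map φ ≤ J) (a : I) :
    BlowUpChart a →+* BlowUpChart (mapGen φ h a) :=
  HomogeneousLocalization.map (reesMap φ h) (powers_reesGen_le φ h a)

lemma blowUpChartMap_chartFrac (φ : R →+* S) (h : I.map φ ≤ J) (a : I) (n : ℕ) (g : R)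
    (hg : g ∈ I ^ n) :
    blowUpChartMap φ h a (chartFrac a n g hg) =
      chartFrac (mapGen φ h a) n (φ g) (map_mem_pow h hg) := by
  rw [chartFrac, Away.mk, blowUpChartMap, HomogeneousLocalization.map_mk,
    HomogeneousLocalization.ext_iff_val, val_chartFrac, HomogeneousLocalization.val_mk]
  congr 1
  · exact reesMap_reesMonomial φ h hg
  · refine Subtype.ext ?_
    change reesMap φ h (reesGen a ^ n) = _
    rw [map_pow, reesMap_reesGen]

lemma blowUpChartMap_comp_toBlowUpChart (φ : R →+* S) (h : I.map φ ≤ J) (a : I) :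
    (blowUpChartMap φ h a).comp (toBlowUpChart a) =
      (toBlowUpChart (mapGen φ h a)).comp φ := by
  ext r
  simp only [RingHom.comp_apply, toBlowUpChart_apply, blowUpChartMap_chartFrac]

/-- The open immersion of the chart `D₊(a * t)` in the blow-up. -/
def chartι (a : I) : Spec (.of (BlowUpChart a)) ⟶ affineBlowUp I :=
  Proj.awayι (reesGrading I) (reesGen a) (reesGen_mem a) one_pos

instance (a : I) : IsOpenImmersion (chartι a) :=
  inferInstanceAs (IsOpenImmersion (Proj.awayι (reesGrading I) (reesGen a) (reesGen_mem a) one_pos))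

lemma chartι_affineBlowUpToSpec (a : I) :
    chartι a ≫ affineBlowUpToSpec I = Spec.map (CommRingCat.ofHom (toBlowUpChart a)) := by
  refine
    (Proj.awayι_toSpecZero_assoc (reesGrading I) (reesGen a) (reesGen_mem a) one_pos _).trans ?_
  rw [← Spec.map_comp]
  rfl

lemma awayι_map_of_eq {f : reesAlgebra I} {g : reesAlgebra J} (hf : f ∈ reesGrading I 1)
    (hg : g ∈ reesGrading J 1) (F : reesGrading I →+*ᵍ reesGrading J)
    (hF : irrelevant (reesGrading J) ≤ (irrelevant (reesGrading I)).map F) (h : F f = g)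
    (h' : Submonoid.powers f ≤ (Submonoid.powers g).comap F) :
    Proj.awayι (reesGrading J) g hg one_pos ≫ Proj.map F hF =
      Spec.map (CommRingCat.ofHom (HomogeneousLocalization.map F h')) ≫
        Proj.awayι (reesGrading I) f hf one_pos := by
  subst h
  exact Proj.awayι_comp_map F hF one_pos f hf

lemma chartι_affineBlowUpMap (φ : R →+* S) (h : I.map φ = J) (a : I) :
    chartι (mapGen φ h.le a) ≫ affineBlowUpMap φ h =
      Spec.map (CommRingCat.ofHom (blowUpChartMap φ h.le a)) ≫ chartι a :=
  awayι_map_of_eq _ _ _ _ (reesMap_reesGen ..) _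

/-- The cover of the blow-up by the charts `D₊(a * t)`, for `a` in a family of generators of
the ideal. -/
def chartCover {ι : Type u} (b : ι → I) (hb : I ≤ Ideal.span (Set.range fun i => (b i : R))) :
    (affineBlowUp I).OpenCover :=
  (Proj.affineOpenCoverOfIrrelevantLESpan (reesGrading I) (fun i => reesGen (b i))
    (fun i => reesGen_mem (b i)) (fun _ => one_pos) (irrelevant_le_span_reesGen b hb)).openCover

lemma affineBlowUpMap_id (h : I.map (RingHom.id R) = I) :
    affineBlowUpMap (RingHom.id R) h = 𝟙 _ := by
  have key (F : reesGrading I →+*ᵍ reesGrading I) (hF : F = .id _)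
      (hF' : irrelevant (reesGrading I) ≤ (irrelevant (reesGrading I)).map F) :
      Proj.map F hF' = 𝟙 _ := by
    subst hF
    exact Proj.map_id
  exact key _ reesMap_id _

lemma affineBlowUpMap_comp (φ : R →+* S) (h : I.map φ = J) (ψ : S →+* T) (h' : J.map ψ = L)
    (h'' : I.map (ψ.comp φ) = L) :
    affineBlowUpMap (ψ.comp φ) h'' = affineBlowUpMap ψ h' ≫ affineBlowUpMap φ h := by
  have key (F : reesGrading I →+*ᵍ reesGrading L)
      (hF : F = (reesMap ψ h'.le).comp (reesMap φ h.le))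
      (hF' : irrelevant (reesGrading L) ≤ (irrelevant (reesGrading I)).map F) :
      Proj.map F hF' = affineBlowUpMap ψ h' ≫ affineBlowUpMap φ h := by
    subst hF
    exact Proj.map_comp ..
  exact key _ (reesMap_comp ..) _

lemma isPullback_chartι (φ : R →+* S) (h : I.map φ = J) (a : I) :
    IsPullback (Spec.map (CommRingCat.ofHom (blowUpChartMap φ h.le a)))
      (chartι (mapGen φ h.le a)) (chartι a) (affineBlowUpMap φ h) := by
  refine IsOpenImmersion.isPullback _ _ _ _ (chartι_affineBlowUpMap φ h a) ?_
  rw [show (chartι a).opensRange = Proj.basicOpen (reesGrading I) (reesGen a) from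
      Proj.opensRange_awayι _ _ (reesGen_mem a) one_pos,
    show (chartι (mapGen φ h.le a)).opensRange =
      Proj.basicOpen (reesGrading J) (reesGen (mapGen φ h.le a)) from
        Proj.opensRange_awayι _ _ (reesGen_mem _) one_pos, ← reesMap_reesGen]
  rfl

lemma isPullback_of_isPullback_cover {W X Y Z : Scheme.{u}} (fWX : W ⟶ X) (fWY : W ⟶ Y)
    (fXZ : X ⟶ Z) (fYZ : Y ⟶ Z) (𝒰 : X.OpenCover) (V : 𝒰.I₀ → Scheme.{u})
    (p : ∀ i, V i ⟶ 𝒰.X i) (q : ∀ i, V i ⟶ W)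
    (h₁ : ∀ i, IsPullback (p i) (q i) (𝒰.f i) fWX)
    (h₂ : ∀ i, IsPullback (p i) (q i ≫ fWY) (𝒰.f i ≫ fXZ) fYZ) :
    IsPullback fWX fWY fXZ fYZ := by
  refine Scheme.isPullback_of_openCover _ _ _ _ 𝒰 fun i => ?_
  refine (h₂ i).of_iso (h₁ i).flip.isoPullback (Iso.refl _) (Iso.refl _) (Iso.refl _) ?_ ?_ ?_ ?_
  · exact (Category.comp_id _).trans (h₁ i).flip.isoPullback_hom_snd.symm
  · exact (Category.comp_id _).trans ((h₁ i).flip.isoPullback_hom_fst_assoc fWY).symm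
  · simp
  · simp

/-- Rings `A` and `B` whose elements are fractions `g / a ^ n` with `g ∈ I ^ n`, respectively
`g ∈ (I S) ^ n`, are related by base change along `R → S` if `S` is flat over `R`. -/
lemma isPushout_of_fractions {A B : Type u} [CommRing A] [CommRing B] [Algebra R S]
    [Module.Flat R S] (h : I.map (algebraMap R S) = J) (a : R) (ha : a ∈ I)
    (α : R →+* A) (β : S →+* B) (γ : A →+* B) (hγ : γ.comp α = β.comp (algebraMap R S))
    (f : ∀ n, (I ^ n : Ideal R) → A) (f' : ∀ n, (J ^ n : Ideal S) → B)
    (f_add : ∀ n g g', f n (g + g') = f n g + f n g')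
    (f_smul : ∀ n r g, f n (r • g) = α r * f n g)
    (f'_add : ∀ n g g', f' n (g + g') = f' n g + f' n g')
    (f'_smul : ∀ n r g, f' n (r • g) = β r * f' n g)
    (f_surj : ∀ z, ∃ n g, f n g = z) (f'_surj : ∀ z, ∃ n g, f' n g = z)
    (f_pow : ∀ m n (g : (I ^ n : Ideal R)), f (m + n) ⟨a ^ m * g, pow_add I m n ▸ Ideal.mul_mem_mul
      (Ideal.pow_mem_pow ha m) g.2⟩ = f n g)
    (f'_zero : ∀ n (g : (J ^ n : Ideal S)), f' n g = 0 → ∃ m, algebraMap R S a ^ m * g = 0)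
    (hf : ∀ n (g : (I ^ n : Ideal R)), γ (f n g) = f' n ⟨algebraMap R S g, map_mem_pow h.le g.2⟩) :
    IsPushout (CommRingCat.ofHom (algebraMap R S)) (CommRingCat.ofHom α)
      (CommRingCat.ofHom β) (CommRingCat.ofHom γ) := by
  let _ := α.toAlgebra
  let _ := β.toAlgebra
  let _ := γ.toAlgebra
  let _ := (β.comp (algebraMap R S)).toAlgebra
  have : IsScalarTower R S B := .of_algebraMap_eq' rfl
  have : IsScalarTower R A B := .of_algebraMap_eq' hγ.symm
  refine CommRingCat.isPushout_iff_isPushout.mpr ⟨?_⟩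
  -- the fractions with denominator `a ^ n`, and multiplication `S ⊗ I ^ n → S`
  let ρ (n : ℕ) : (I ^ n : Ideal R) →ₗ[R] A :=
    { toFun := f n, map_add' := f_add n, map_smul' := f_smul n }
  let μ (n : ℕ) : S ⊗[R] (I ^ n : Ideal R) →ₗ[R] S :=
    (TensorProduct.rid R S).toLinearMap ∘ₗ ((I ^ n : Ideal R).subtype).lTensor S
  have hμ (n : ℕ) : Function.Injective (μ n) :=
    (TensorProduct.rid R S).injective.comp
      (Module.Flat.lTensor_preserves_injective_linearMap _ Subtype.val_injective)
  have μ_tmul (n : ℕ) (s : S) (g) : μ n (s ⊗ₜ g) = s * algebraMap R S g := by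
    simp [μ, Algebra.smul_def, mul_comm]
  have μ_smul (n : ℕ) (s : S) (y) : μ n (s • y) = s * μ n y := by
    induction y using TensorProduct.induction_on with
    | zero => simp
    | tmul t g => rw [TensorProduct.smul_tmul', μ_tmul, μ_tmul, smul_eq_mul, mul_assoc]
    | add y z hy hz => rw [smul_add, map_add, map_add, hy, hz, mul_add]
  have hμ_mem (n : ℕ) (y) : μ n y ∈ J ^ n := by
    induction y using TensorProduct.induction_on with
    | zero => simp
    | tmul s g =>
      rw [μ_tmul]
      exact Ideal.mul_mem_left _ _ (map_mem_pow h.le g.2)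
    | add y z hy hz => rw [map_add]; exact add_mem hy hz
  let Φ : S ⊗[R] A →ₗ[R] B :=
    (Algebra.TensorProduct.lift (Algebra.ofId S B)
      (IsScalarTower.toAlgHom R A B) fun _ _ => Commute.all _ _).toLinearMap.restrictScalars R
  have Φ_tmul (s : S) (z : A) : Φ (s ⊗ₜ z) = β s * γ z := rfl
  have f'_map_zero (n) : f' n 0 = 0 := by simpa using f'_add n 0 0
  have hΦ (n : ℕ) (y) : Φ ((ρ n).lTensor S y) = f' n ⟨μ n y, hμ_mem n y⟩ := by
    induction y using TensorProduct.induction_on with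
    | zero =>
      rw [map_zero, map_zero, ← f'_map_zero n]
      congr 1
    | tmul s g =>
      rw [LinearMap.lTensor_tmul, Φ_tmul, show ρ n g = f n g from rfl, hf, ← f'_smul]
      congr 1
      exact Subtype.ext (μ_tmul n s g).symm
    | add y z hy hz =>
      rw [map_add, map_add, hy, hz, ← f'_add]
      congr 1
      exact Subtype.ext (map_add (μ n) y z).symm
  -- multiplication by `a ^ m` as a map `I ^ n → I ^ (m + n)`
  let σ (m n k : ℕ) (hk : m + n = k) : (I ^ n : Ideal R) →ₗ[R] (I ^ k : Ideal R) :=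
    { toFun g :=
        ⟨a ^ m * g, hk ▸ pow_add I m n ▸ Ideal.mul_mem_mul (Ideal.pow_mem_pow ha m) g.2⟩
      map_add' g g' := Subtype.ext (mul_add ..)
      map_smul' r g := Subtype.ext (mul_left_comm ..) }
  have ρ_σ (m n k : ℕ) (hk) (y) : (ρ k).lTensor S ((σ m n k hk).lTensor S y) =
      (ρ n).lTensor S y := by
    rw [← LinearMap.comp_apply, ← LinearMap.lTensor_comp]
    congr 2
    subst hk
    exact LinearMap.ext (f_pow m n)
  have μ_σ (m n k : ℕ) (hk) (y) :
      μ k ((σ m n k hk).lTensor S y) = algebraMap R S a ^ m * μ n y := by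
    induction y using TensorProduct.induction_on with
    | zero => simp
    | tmul s g =>
      rw [LinearMap.lTensor_tmul, μ_tmul, μ_tmul]
      simp only [σ, LinearMap.coe_mk, AddHom.coe_mk, map_mul, map_pow]
      ring
    | add y z hy hz => rw [map_add, map_add, map_add, hy, hz, mul_add]
  -- a common denominator
  have key (x : S ⊗[R] A) : ∃ n y, (ρ n).lTensor S y = x := by
    induction x using TensorProduct.induction_on with
    | zero => exact ⟨0, 0, map_zero _⟩
    | tmul s z =>
      obtain ⟨n, g, rfl⟩ := f_surj z
      exact ⟨n, s ⊗ₜ g, rfl⟩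
    | add x x' hx hx' =>
      obtain ⟨n, y, rfl⟩ := hx
      obtain ⟨n', y', rfl⟩ := hx'
      exact ⟨n + n', (σ n' n _ (add_comm _ _)).lTensor S y + (σ n n' _ rfl).lTensor S y', by
        rw [map_add, ρ_σ n' n _ (add_comm _ _), ρ_σ n n' _ rfl]⟩
  have hinj : Function.Injective Φ := by
    rw [injective_iff_map_eq_zero]
    intro x hx
    obtain ⟨n, y, rfl⟩ := key x
    rw [hΦ] at hx
    obtain ⟨m, hm⟩ := f'_zero _ _ hx
    have h0 : (σ m n _ rfl).lTensor S y = 0 := hμ _ (by rw [μ_σ m n _ rfl, map_zero]; exact hm)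
    rw [← ρ_σ m n _ rfl, h0, map_zero]
  have hsurj : Function.Surjective Φ := by
    intro z
    obtain ⟨n, g, rfl⟩ := f'_surj z
    have hg : (g : S) ∈ LinearMap.range (μ n) := by
      have hg' : (g : S) ∈ (I ^ n).map (algebraMap R S) := by
        rw [Ideal.map_pow, h]
        exact g.2
      generalize (g : S) = b at hg'
      induction hg' using Submodule.span_induction with
      | mem x hx =>
        obtain ⟨r, hr, rfl⟩ := hx
        exact ⟨1 ⊗ₜ ⟨r, hr⟩, by rw [μ_tmul, one_mul]⟩
      | zero => exact zero_mem _
      | add x y _ _ hx hy => exact add_mem hx hy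
      | smul s x _ hx =>
        obtain ⟨y, rfl⟩ := hx
        exact ⟨s • y, μ_smul n s y⟩
    obtain ⟨y, hy⟩ := hg
    exact ⟨_, (hΦ n y).trans (by congr 1; exact Subtype.ext hy)⟩
  have hΦ_eq : TensorProduct.lift (((Algebra.linearMap S <| Module.End S (A →ₗ[R] B)).flip
      (IsScalarTower.toAlgHom R A B).toLinearMap).restrictScalars R) = Φ :=
    TensorProduct.ext' fun s z => Algebra.smul_def s (γ z)
  exact (congr_arg (fun F : S ⊗[R] A →ₗ[R] B => Function.Bijective F) hΦ_eq).mpr ⟨hinj, hsurj⟩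

/-- The charts `D₊(a * t)` are compatible with flat base change. -/
lemma isPushout_blowUpChart [Algebra R S] [Module.Flat R S] (h : I.map (algebraMap R S) = J)
    (a : I) :
    IsPushout (CommRingCat.ofHom (algebraMap R S)) (CommRingCat.ofHom (toBlowUpChart a))
      (CommRingCat.ofHom (toBlowUpChart (mapGen (algebraMap R S) h.le a)))
      (CommRingCat.ofHom (blowUpChartMap (algebraMap R S) h.le a)) := by
  refine isPushout_of_fractions h a a.2 _ _ _ (blowUpChartMap_comp_toBlowUpChart _ h.le a)
    (fun n g => chartFrac a n g g.2) (fun n g => chartFrac _ n g g.2)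
    (fun n g g' => chartFrac_add a n g.2 g'.2)
    (fun n r g => (toBlowUpChart_mul_chartFrac a r n g.2).symm)
    (fun n g g' => chartFrac_add _ n g.2 g'.2)
    (fun n r g => (toBlowUpChart_mul_chartFrac _ r n g.2).symm) (fun z => ?_) (fun z => ?_)
    (fun m n g => chartFrac_pow_mul a m n g.2)
    (fun n g hg => (chartFrac_eq_zero_iff _ n (g : S) g.2).mp hg)
    (fun n g => blowUpChartMap_chartFrac _ h.le a n g g.2)
  · obtain ⟨n, g, hg, rfl⟩ := exists_eq_chartFrac a z
    exact ⟨n, ⟨g, hg⟩, rfl⟩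
  · obtain ⟨n, g, hg, rfl⟩ := exists_eq_chartFrac _ z
    exact ⟨n, ⟨g, hg⟩, rfl⟩

/-- Blow-ups are compatible with flat base change. -/
lemma isPullback_affineBlowUpMap (φ : R →+* S) (hφ : φ.Flat) (h : I.map φ = J) :
    IsPullback (affineBlowUpMap φ h) (affineBlowUpToSpec J) (affineBlowUpToSpec I)
      (Spec.map (CommRingCat.ofHom φ)) := by
  let _ := φ.toAlgebra
  have : Module.Flat R S := hφ
  have key (a : I) : IsPullback (Spec.map (CommRingCat.ofHom (blowUpChartMap φ h.le a)))
      (chartι (mapGen φ h.le a) ≫ affineBlowUpToSpec J) (chartι a ≫ affineBlowUpToSpec I)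
      (Spec.map (CommRingCat.ofHom φ)) := by
    rw [chartι_affineBlowUpToSpec, chartι_affineBlowUpToSpec]
    exact (isPullback_SpecMap_of_isPushout _ _ _ _ (isPushout_blowUpChart (S := S) h a)).flip
  exact isPullback_of_isPullback_cover _ _ _ _
    (chartCover id (by simp : I ≤ Ideal.span (Set.range fun a : I => ((id a : I) : R)))) _ _ _
    (fun a => isPullback_chartι φ h a) key

end BaseChange
end

noncomputable section

/-! ### Existence of blow-ups -/

section Gluing

variable {X : Scheme.{u}}

/-- The restriction map between the rings of functions on two affine opens. -/
def affineRes {U V : X.affineOpens} (h : U ≤ V) : Γ(X, V.1) →+* Γ(X, U.1) :=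
  (X.presheaf.map (homOfLE h).op).hom

lemma map_affineRes (I : X.IdealSheafData) {U V : X.affineOpens} (h : U ≤ V) :
    (I.ideal V).map (affineRes h) = I.ideal U :=
  I.map_ideal h

lemma affineRes_self (U : X.affineOpens) : affineRes (le_refl U) = RingHom.id _ := by
  have : X.presheaf.map (homOfLE (le_refl U.1)).op = 𝟙 _ := X.presheaf.map_id _
  exact congr_arg CommRingCat.Hom.hom this

lemma affineRes_comp {U V W : X.affineOpens} (h : U ≤ V) (h' : V ≤ W) :
    (affineRes h).comp (affineRes h') = affineRes (h.trans h') := by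
  have := X.presheaf.map_comp (homOfLE (show V.1 ≤ W.1 from h')).op
    (homOfLE (show U.1 ≤ V.1 from h)).op
  exact congr_arg CommRingCat.Hom.hom this.symm

lemma specMap_affineRes_fromSpec {U V : X.affineOpens} (h : U ≤ V) :
    Spec.map (CommRingCat.ofHom (affineRes h)) ≫ V.2.fromSpec = U.2.fromSpec :=
  V.2.map_fromSpec U.2 (homOfLE (show U.1 ≤ V.1 from h)).op

lemma homOfLE_isoSpec_hom {U V : X.affineOpens} (h : U ≤ V) :
    X.homOfLE h ≫ V.2.isoSpec.hom =
      U.2.isoSpec.hom ≫ Spec.map (CommRingCat.ofHom (affineRes h)) := by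
  have := V.2.isOpenImmersion_fromSpec
  rw [← cancel_mono V.2.fromSpec, Category.assoc, Category.assoc, specMap_affineRes_fromSpec,
    V.2.isoSpec_hom_fromSpec, U.2.isoSpec_hom_fromSpec, Scheme.homOfLE_ι]

lemma flat_affineRes {U V : X.affineOpens} (h : U ≤ V) : (affineRes h).Flat := by
  have := V.2.isOpenImmersion_fromSpec
  have : IsOpenImmersion (Spec.map (CommRingCat.ofHom (affineRes h)) ≫ V.2.fromSpec) := by
    rw [specMap_affineRes_fromSpec]
    exact U.2.isOpenImmersion_fromSpec
  have := IsOpenImmersion.of_comp (Spec.map (CommRingCat.ofHom (affineRes h))) V.2.fromSpec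
  exact (HasRingHomProperty.Spec_iff (P := @Flat)).mp
    (inferInstance : Flat (Spec.map (CommRingCat.ofHom (affineRes h))))

lemma isPullback_blowUpFunctor (I : X.IdealSheafData) {U V : X.affineOpens} (h : U ≤ V) :
    IsPullback (affineBlowUpMap (affineRes h) (map_affineRes I h))
      (affineBlowUpToSpec (I.ideal U) ≫ U.2.isoSpec.inv)
      (affineBlowUpToSpec (I.ideal V) ≫ V.2.isoSpec.inv) (X.homOfLE h) := by
  have h₁ := isPullback_affineBlowUpMap _ (flat_affineRes h) (map_affineRes I h)
  have h₂ : IsPullback (Spec.map (CommRingCat.ofHom (affineRes h))) U.2.isoSpec.inv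
      V.2.isoSpec.inv (X.homOfLE h) := by
    refine IsPullback.of_vert_isIso ⟨?_⟩
    rw [Iso.eq_inv_comp, ← Category.assoc, ← homOfLE_isoSpec_hom, Category.assoc,
      Iso.hom_inv_id, Category.comp_id]
  exact h₁.paste_vert h₂

/-- The functor of which the blow-up is the colimit. -/
def blowUpFunctor (I : X.IdealSheafData) : X.affineOpens ⥤ Scheme.{u} where
  obj U := affineBlowUp (I.ideal U)
  map h := affineBlowUpMap (affineRes h.le) (map_affineRes I h.le)
  map_id U := by
    have key (φ : Γ(X, U.1) →+* Γ(X, U.1)) (hφ : φ = .id _) (h) :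
        affineBlowUpMap (I := I.ideal U) (J := I.ideal U) φ h = 𝟙 _ := by
      subst hφ
      exact affineBlowUpMap_id _
    exact key _ (affineRes_self U) _
  map_comp {U V W} h h' := by
    have key (φ : Γ(X, W.1) →+* Γ(X, U.1)) (hφ : φ = (affineRes h.le).comp (affineRes h'.le)) (H) :
        affineBlowUpMap (I := I.ideal W) (J := I.ideal U) φ H =
          affineBlowUpMap (affineRes h.le) (map_affineRes I h.le) ≫
            affineBlowUpMap (affineRes h'.le) (map_affineRes I h'.le) := by
      subst hφ
      exact affineBlowUpMap_comp ..
    exact key _ (affineRes_comp ..).symm _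

/-- The blow-ups of the affine opens of `X`, as a gluing datum over `X`. -/
def blowUpGluing (I : X.IdealSheafData) : X.directedAffineCover.RelativeGluingData where
  functor := blowUpFunctor I
  natTrans :=
    { app U := affineBlowUpToSpec (I.ideal U) ≫ (IsAffineOpen.isoSpec (Subtype.prop U)).inv
      naturality _ _ h := (isPullback_blowUpFunctor I h.le).w }
  equifibered _ _ h := isPullback_blowUpFunctor I h.le

/-- Every quasi-coherent sheaf of ideals has a blow-up. -/
lemma exists_isBlowUpAlong (I : X.IdealSheafData) :
    ∃ (Y : Scheme.{u}) (π : Y ⟶ X), IsBlowUpAlong π I ∧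
      ∀ U : X.affineOpens, ∃ j : affineBlowUp (I.ideal U) ⟶ Y, IsOpenImmersion j ∧
        j ≫ π = affineBlowUpToSpec (I.ideal U) ≫ U.2.fromSpec := by
  have key (U : X.affineOpens) : ∃ j : affineBlowUp (I.ideal U) ⟶ (blowUpGluing I).glued,
      IsPullback (affineBlowUpToSpec (I.ideal U) ≫ U.2.isoSpec.inv) j U.1.ι
        (blowUpGluing I).toBase :=
    ⟨_, (blowUpGluing I).isPullback_natTrans_ι_toBase U⟩
  refine ⟨(blowUpGluing I).glued, (blowUpGluing I).toBase, fun U => ?_, fun U => ?_⟩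
  · obtain ⟨j, hj⟩ := key U
    refine ⟨((isPullback_morphismRestrict _ U.1).isoIsPullback _ _ hj), ?_⟩
    have h := (isPullback_morphismRestrict (blowUpGluing I).toBase U.1).isoIsPullback_hom_fst _ _ hj
    refine Eq.trans ?_ congr($h ≫ U.2.isoSpec.hom)
    rw [Category.assoc, Category.assoc, Iso.inv_hom_id, Category.comp_id]
  · obtain ⟨j, hj⟩ := key U
    refine ⟨j, ?_, ?_⟩
    · exact MorphismProperty.of_isPullback (P := @IsOpenImmersion) hj.flip.flip inferInstance
    · rw [← hj.w, Category.assoc]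
      rfl

lemma locallyOfFiniteType_affineBlowUpToSpec {R : Type u} [CommRing R] [IsNoetherianRing R]
    (I : Ideal R) : LocallyOfFiniteType (affineBlowUpToSpec I) := by
  have h₀ : Algebra.FiniteType (reesGrading I 0) (reesAlgebra I) := by
    refine RingHom.finiteType_algebraMap.mp (RingHom.FiniteType.of_comp_finiteType
      (f := (CommRingCat.ofHom (algebraMap R (reesGrading I 0)) :
        CommRingCat.of R ⟶ .of (reesGrading I 0)).hom) ?_)
    exact RingHom.finiteType_algebraMap.mpr (inferInstance : Algebra.FiniteType R (reesAlgebra I))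
  have h₁ : LocallyOfFiniteType (Spec.map
      (CommRingCat.ofHom (algebraMap R (reesGrading I 0)) : .of R ⟶ .of (reesGrading I 0))) := by
    refine (HasRingHomProperty.Spec_iff (P := @LocallyOfFiniteType)).mpr ?_
    refine RingHom.FiniteType.of_surjective _ fun f => ?_
    obtain ⟨r, hr, h⟩ := exists_eq_reesMonomial f.2
    exact ⟨r, Subtype.ext h.symm⟩
  have h₂ : LocallyOfFiniteType (Proj.toSpecZero (reesGrading I)) := inferInstance
  exact MorphismProperty.comp_mem _ _ _ h₂ h₁

/-- The blow-up of a locally noetherian scheme is locally of finite type. -/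
lemma IsBlowUpAlong.locallyOfFiniteType [IsLocallyNoetherian X] {Y : Scheme.{u}} {π : Y ⟶ X}
    {I : X.IdealSheafData} (h : IsBlowUpAlong π I) : LocallyOfFiniteType π := by
  have : IsZariskiLocalAtTarget @LocallyOfFiniteType :=
    HasRingHomProperty.instIsZariskiLocalAtTarget (P := @LocallyOfFiniteType)
  refine (IsZariskiLocalAtTarget.iff_of_iSup_eq_top (P := @LocallyOfFiniteType)
    (fun U : X.affineOpens => U.1) (iSup_affineOpens_eq_top X)).mpr fun U => ?_
  obtain ⟨e, he⟩ := h U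
  have := IsLocallyNoetherian.component_noetherian U
  have := locallyOfFiniteType_affineBlowUpToSpec (I.ideal U)
  have h : π ∣_ U.1 = e.hom ≫ affineBlowUpToSpec (I.ideal U) ≫ U.2.isoSpec.inv := by
    rw [← Category.assoc, he, Category.assoc, Iso.hom_inv_id, Category.comp_id]
  rw [h]
  infer_instance

end Gluing
end

/-! ### Centers in blow-ups -/

section Norm

variable {R K : Type*} [CommRing R] [NormedField K] [IsUltrametricDist K]

/-- If `P : R → K` has values of norm at most one, then the bound `c` on the norms of generators
of an ideal `J` gives the bound `c ^ n` on `J ^ n`. -/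
lemma norm_le_pow_of_mem_span_pow (P : R →+* K) (hP : ∀ r, ‖P r‖ ≤ 1) {T : Set R} {c : ℝ}
    (hc : 0 ≤ c) (hT : ∀ r ∈ T, ‖P r‖ ≤ c) (n : ℕ) : ∀ r ∈ Ideal.span T ^ n, ‖P r‖ ≤ c ^ n := by
  -- the elements of norm at most `d` form an ideal
  let N (d : ℝ) (hd : 0 ≤ d) : Ideal R :=
    { carrier := {r | ‖P r‖ ≤ d}
      zero_mem' := by simpa
      add_mem' {r r'} hr hr' := by
        change ‖P (r + r')‖ ≤ d
        rw [map_add]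
        exact (IsUltrametricDist.norm_add_le_max _ _).trans (max_le hr hr')
      smul_mem' r r' hr' := by
        change ‖P (r * r')‖ ≤ d
        rw [map_mul, norm_mul]
        exact (mul_le_of_le_one_left (norm_nonneg _) (hP r)).trans hr' }
  induction n with
  | zero => simpa using hP
  | succ n ih =>
    have h : Ideal.span T ^ n * Ideal.span T ≤ N (c ^ (n + 1)) (pow_nonneg hc _) := by
      have h1 : Ideal.span T ≤ N c hc := Ideal.span_le.mpr hT
      refine Ideal.mul_le.mpr fun r hr r' hr' => ?_
      change ‖P (r * r')‖ ≤ c ^ (n + 1)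
      rw [map_mul, norm_mul, pow_succ]
      exact mul_le_mul (ih r hr) (h1 hr') (norm_nonneg _) (pow_nonneg hc _)
    rw [pow_succ]
    exact h

end Norm

section Scheme

variable {X : Scheme.{u}}

/-- Finitely many elements of the residue field of a point of an affine open `U` are values of
fractions of functions on `U` with a common denominator. -/
lemma exists_common_denominator {U : X.Opens} (hU : IsAffineOpen U) (p : X) (hp : p ∈ U)
    (F : Finset (X.residueField p)) :
    ∃ b : Γ(X, U), X.evaluation U p hp b ≠ 0 ∧
      ∀ f ∈ F, ∃ a : Γ(X, U), X.evaluation U p hp a = f * X.evaluation U p hp b := by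
  classical
  let _ := (X.presheaf.germ U p hp).hom.toAlgebra
  have : IsLocalization.AtPrime (X.presheaf.stalk p) (hU.primeIdealOf ⟨p, hp⟩).asIdeal :=
    hU.isLocalization_stalk ⟨p, hp⟩
  choose g hg using X.residue_surjective p
  obtain ⟨b, hb⟩ := IsLocalization.exist_integer_multiples_of_finset
    (hU.primeIdealOf ⟨p, hp⟩).asIdeal.primeCompl (F.image g)
  refine ⟨b, ?_, fun f hf => ?_⟩
  · have h := IsLocalization.map_units (X.presheaf.stalk p) b
    exact (h.map (X.residue p).hom).ne_zero
  · obtain ⟨a, ha⟩ := hb (g f) (Finset.mem_image_of_mem g hf)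
    refine ⟨a, ?_⟩
    have := congr_arg (X.residue p).hom ha
    rw [Algebra.smul_def, map_mul, mul_comm] at this
    refine this.trans ?_
    congr 1
    exact hg f

/-- An ideal of the ring of functions on an affine open of a locally noetherian scheme extends
to a quasi-coherent sheaf of ideals. -/
lemma exists_ideal_eq [IsLocallyNoetherian X] (U : X.affineOpens) (I₀ : Ideal Γ(X, U.1)) :
    ∃ I : X.IdealSheafData, I.ideal U = I₀ := by
  have := IsLocallyNoetherian.component_noetherian U
  let A := CommRingCat.of (Γ(X, U.1) ⧸ I₀)
  let ψ : Γ(X, U.1) ⟶ A := CommRingCat.ofHom (Ideal.Quotient.mk I₀)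
  let f : Spec A ⟶ X := Spec.map ψ ≫ U.2.fromSpec
  have : IsNoetherianRing A := inferInstanceAs (IsNoetherianRing (Γ(X, U.1) ⧸ I₀))
  have : QuasiCompact f := inferInstance
  refine ⟨f.ker, ?_⟩
  have := U.2.isOpenImmersion_fromSpec
  have hf : ⊤ ≤ f ⁻¹ᵁ U.1 := fun y _ =>
    U.2.range_fromSpec.le (show f y ∈ Set.range U.2.fromSpec from ⟨Spec.map ψ y, rfl⟩)
  have key : f.appLE U.1 ⊤ hf = ψ ≫ (Scheme.ΓSpecIso A).inv := by
    apply Spec.map_injective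
    rw [← cancel_mono U.2.fromSpec,
      IsAffineOpen.SpecMap_appLE_fromSpec f U.2 (isAffineOpen_top _) hf,
      IsAffineOpen.fromSpec_top, Scheme.isoSpec_Spec_inv, Spec.map_comp, Category.assoc]
  have h_top : ∀ (V : (Spec A).Opens) (h : V ≤ f ⁻¹ᵁ U.1), V = ⊤ → ∀ r,
      f.appLE U.1 V h r = 0 ↔ f.appLE U.1 ⊤ hf r = 0 := by
    rintro _ _ rfl r
    rfl
  rw [Scheme.Hom.ker_apply]
  ext r
  rw [RingHom.mem_ker, ← Ideal.Quotient.eq_zero_iff_mem, Scheme.Hom.app_eq_appLE]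
  refine (h_top _ le_rfl (top_le_iff.mp hf) r).trans ?_
  rw [key]
  exact map_eq_zero_iff _ (ConcreteCategory.bijective_of_isIso (Scheme.ΓSpecIso A).inv).1

/-- A morphism from the spectrum of a local ring factors through any affine open that contains
the image of the closed point. -/
lemma exists_eq_specMap_fromSpec {A : CommRingCat.{u}} [IsLocalRing A] (l : Spec A ⟶ X)
    {U : X.Opens} (hU : IsAffineOpen U) (h : l (IsLocalRing.closedPoint A) ∈ U) :
    ∃ ψ : Γ(X, U) ⟶ A, l = Spec.map ψ ≫ hU.fromSpec := by
  have := hU.isOpenImmersion_fromSpec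
  have hl : l ⁻¹ᵁ U = ⊤ := (IsLocalRing.closed_point_mem_iff (U := l ⁻¹ᵁ U)).mp h
  have hr : Set.range l ⊆ Set.range hU.fromSpec := by
    rw [hU.range_fromSpec]
    rintro _ ⟨y, rfl⟩
    exact hl.ge (Set.mem_univ y)
  obtain ⟨ψ, hψ⟩ := Spec.map_surjective (IsOpenImmersion.lift hU.fromSpec l hr)
  exact ⟨ψ, by rw [hψ, IsOpenImmersion.lift_fac]⟩

end Scheme

section BlowUp

variable {k : Type u} [NormedField k] [IsUltrametricDist k]
  {X : Scheme.{u}} {s : X ⟶ Spec (.of k)}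

lemma Centered.IsBlowUpOf.locallyOfFiniteType [LocallyOfFiniteType s] {x : AnPoint s}
    {Z : Centered x} (h : Z.IsBlowUpOf) : LocallyOfFiniteType Z.toBase := by
  obtain ⟨π, I, hI, hπ, -⟩ := h
  have := LocallyOfFiniteType.isLocallyNoetherian s
  have := hI.locallyOfFiniteType
  rw [hπ]
  infer_instance

/-- If `x` has a center in some blow-up of `X`, then any finite set of elements of `κ(pt)` of norm
at most one consists of functions defined at the center of `x` in a suitable blow-up of `X`. -/
lemma exists_isBlowUpOf_forall_residue_mem_range [LocallyOfFiniteType s] {x : AnPoint s}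
    {Z₀ : Centered x} (h₀ : Z₀.IsBlowUpOf)
    (F : Finset (X.residueField x.pt)) (hF : ∀ f ∈ F, x.toH f ∈ unitBall x.H) :
    ∃ Z : Centered x, Z.IsBlowUpOf ∧ ∀ f ∈ F, ∀ hf : x.toH f ∈ unitBall x.H,
      IsLocalRing.residue (unitBall x.H) ⟨x.toH f, hf⟩ ∈ Z.resCenter.range := by
  classical
  have := LocallyOfFiniteType.isLocallyNoetherian s
  obtain ⟨π₀, -, -, -, hπ₀⟩ := h₀
  -- an affine neighbourhood of the center of `x` in `X`
  let l : Spec (.of (unitBall x.H)) ⟶ X := Z₀.lift ≫ π₀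
  have hl : x.specHToBall ≫ l = x.specHToPt ≫ X.fromSpecResidueField x.pt := by
    rw [← hπ₀, ← Category.assoc, Z₀.specHToBall_lift, Category.assoc]
  obtain ⟨_, ⟨U, hU, rfl⟩, hc, -⟩ := X.isBasis_affineOpens.exists_subset_of_mem_open
    (Set.mem_univ (l (IsLocalRing.closedPoint (unitBall x.H)))) isOpen_univ
  have := hU.isOpenImmersion_fromSpec
  obtain ⟨ψ, hψ⟩ := exists_eq_specMap_fromSpec (A := .of (unitBall x.H)) l hU hc
  have hp : x.pt ∈ U := by
    have h1 : (x.specHToBall ≫ l) (IsLocalRing.closedPoint x.H) ∈ U := by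
      rw [hψ]
      exact hU.range_fromSpec.le ⟨_, rfl⟩
    have h2 : (x.specHToPt ≫ X.fromSpecResidueField x.pt) (IsLocalRing.closedPoint x.H) = x.pt :=
      (X.range_fromSpecResidueField x.pt).le ⟨_, rfl⟩
    rwa [hl, h2] at h1
  let e : Γ(X, U) ⟶ X.residueField x.pt := X.evaluation U x.pt hp
  have he : Spec.map e ≫ hU.fromSpec = X.fromSpecResidueField x.pt :=
    map_evaluation_fromSpec hU _ hp
  have hψe (r : Γ(X, U)) : ((ψ r : unitBall x.H) : x.H) = x.toH (e r) := by
    have : ψ ≫ CommRingCat.ofHom (unitBall x.H).subtype = e ≫ x.toHHom := by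
      apply Spec.map_injective
      rw [← cancel_mono hU.fromSpec, Spec.map_comp, Spec.map_comp, Category.assoc, Category.assoc,
        he, ← hψ]
      exact hl
    exact congr($this r)
  -- blow up the ideal generated by the numerators and a common denominator of `F`
  obtain ⟨b, hb0, hb⟩ := exists_common_denominator hU x.pt hp F
  choose! a ha using hb
  obtain ⟨I, hI⟩ := exists_ideal_eq ⟨U, hU⟩ (Ideal.span (insert b (a '' F)))
  obtain ⟨Y, π, hπ, hj⟩ := exists_isBlowUpAlong I
  obtain ⟨j, _, hj⟩ := hj ⟨U, hU⟩
  let b' : I.ideal ⟨U, hU⟩ := ⟨b, hI ▸ Ideal.subset_span (Set.mem_insert b _)⟩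
  have ha' : ∀ f ∈ F, a f ∈ I.ideal ⟨U, hU⟩ ^ 1 := fun f hf => by
    rw [pow_one, hI]
    exact Ideal.subset_span (Set.mem_insert_of_mem b (Set.mem_image_of_mem a hf))
  have hnorm (n : ℕ) (g : Γ(X, U)) (hg : g ∈ I.ideal ⟨U, hU⟩ ^ n) :
      ‖x.toH (e g)‖ ≤ ‖x.toH (e b)‖ ^ n := by
    refine norm_le_pow_of_mem_span_pow (x.toH.comp e.hom) (fun r => ?_) (norm_nonneg _) ?_ n g
      (hI ▸ hg)
    · change ‖x.toH (e r)‖ ≤ 1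
      rw [← hψe]
      exact (ψ r : unitBall x.H).2
    · rintro r (rfl | ⟨f, hf, rfl⟩)
      · exact le_rfl
      · change ‖x.toH (e (a f))‖ ≤ _
        rw [ha f hf, map_mul, norm_mul]
        exact mul_le_of_le_one_left (norm_nonneg _) (hF f hf)
  obtain ⟨Φ, hΦ⟩ := exists_hom_blowUpChart b' e.hom hb0
  have hΦ_mem (z : BlowUpChart b') : x.toH (Φ z) ∈ unitBall x.H := by
    obtain ⟨n, g, hg, rfl⟩ := exists_eq_chartFrac b' z
    rw [hΦ, mem_unitBall, map_div₀, map_pow, norm_div, norm_pow]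
    exact div_le_one_of_le₀ (hnorm n g hg) (pow_nonneg (norm_nonneg _) _)
  let Φ' : CommRingCat.of (BlowUpChart b') ⟶ X.residueField x.pt := CommRingCat.ofHom Φ
  let φ : CommRingCat.of (BlowUpChart b') ⟶ .of (unitBall x.H) :=
    CommRingCat.ofHom ((x.toH.comp Φ).codRestrict (unitBall x.H).toSubring hΦ_mem)
  let g₀ : Spec (.of (BlowUpChart b')) ⟶ Y := chartι b' ≫ j
  have hΦ' : Spec.map Φ' ≫ g₀ ≫ π = X.fromSpecResidueField x.pt := by
    have h : CommRingCat.ofHom (toBlowUpChart b') ≫ Φ' = e := by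
      ext r
      change Φ (toBlowUpChart b' r) = e r
      rw [toBlowUpChart_apply, hΦ, pow_zero, div_one]
    rw [Category.assoc, hj, reassoc_of% chartι_affineBlowUpToSpec b', ← Spec.map_comp_assoc, h, he]
  have hφ : x.specHToBall ≫ Spec.map φ ≫ g₀ = x.specHToPt ≫ Spec.map Φ' ≫ g₀ := by
    rw [AnPoint.specHToBall, AnPoint.specHToPt_eq, ← Spec.map_comp_assoc, ← Spec.map_comp_assoc]
    rfl
  let Z : Centered x := {
    scheme := Y
    toBase := π ≫ s ≫ specToBall k
    fromPt := Spec.map Φ' ≫ g₀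
    lift := Spec.map φ ≫ g₀
    specHToBall_lift := hφ
    lift_toBase := by
      apply x.hom_ext_of_specHToBall
      rw [x.specHToBall_specBallToBase, ← hΦ', ← Category.assoc, hφ]
      simp only [Category.assoc] }
  have hZ : Z.fromPt ≫ π = X.fromSpecResidueField x.pt := by
    rw [← hΦ']
    exact Category.assoc ..
  refine ⟨Z, ⟨π, I, hπ, rfl, hZ⟩, fun f hf hf' => ?_⟩
  have : IsOpenImmersion (Y := Z.scheme) g₀ := inferInstanceAs (IsOpenImmersion (chartι b' ≫ j))
  convert Z.residue_mem_range_resCenter g₀ φ rfl (chartFrac b' 1 (a f) (ha' f hf))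
  change x.toH f = x.toH (Φ _)
  rw [hΦ, pow_one]
  congr 1
  exact ((div_eq_iff hb0).mpr (ha f hf)).symm

end BlowUp

/-! ### Members of `B(X, x)` -/

section

variable {k : Type u} [NormedField k] [IsUltrametricDist k]
  {X : Scheme.{u}} {s : X ⟶ Spec (.of k)} {x : AnPoint s}

lemma locallyOfFiniteType_of_mem_B [LocallyOfFiniteType s] {Z : Centered x} (hZ : Z ∈ B x) :
    LocallyOfFiniteType Z.toBase := by
  by_cases hk : unitBall k = ⊤
  · exact (hZ.1 hk).locallyOfFiniteType
  · obtain ⟨j, hj, -⟩ := hZ.2 hk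
    exact hj.locallyOfFiniteType

/-- Any finite set of elements of `κ(pt)` of norm at most one consists of functions defined at the
center of `x` in a suitable member of `B(X, x)`. -/
lemma exists_mem_B_forall_residue_mem_range [IsIntegral X] [IsSeparated s]
    [LocallyOfFiniteType s] [QuasiCompact s] (hB : (B x).Nonempty)
    (F : Finset (X.residueField x.pt)) (hF : ∀ f ∈ F, x.toH f ∈ unitBall x.H) :
    ∃ Z ∈ B x, ∀ f ∈ F, ∀ hf : x.toH f ∈ unitBall x.H,
      IsLocalRing.residue (unitBall x.H) ⟨x.toH f, hf⟩ ∈ Z.resCenter.range := by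
  by_cases hk : unitBall k = ⊤
  · obtain ⟨Z₀, hZ₀⟩ := hB
    obtain ⟨Z, hZ, h⟩ := exists_isBlowUpOf_forall_residue_mem_range (hZ₀.1 hk) F hF
    exact ⟨Z, ⟨fun _ => hZ, fun hk' => absurd hk hk'⟩, h⟩
  · obtain ⟨Z, hZ, h⟩ := exists_isModelOf_forall_residue_mem_range hk x F hF
    exact ⟨Z, ⟨fun hk' => absurd hk' hk, fun _ => hZ⟩, h⟩

lemma fieldFG_resCenter_of_surjective {Z : Centered x} (h : Function.Surjective Z.resCenter) :
    FieldFG Z.resCenter :=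
  (fieldFG_iff _).mpr (RingHom.FiniteType.of_surjective _ h).essFiniteType

end

end BerkovichCenter

theorem corollary3p8 {k : Type u} [NormedField k] [IsUltrametricDist k] [CompleteSpace k]
    {X : Scheme.{u}} (s : X ⟶ Spec (.of k))
    [IsIntegral X] [IsSeparated s] [LocallyOfFiniteType s] [QuasiCompact s]
    (x : BerkovichCenter.AnPoint s) (hx : x ∈ BerkovichCenter.Xval s)
    (hB : (BerkovichCenter.B x).Nonempty) :
    List.TFAE [
      x ∈ BerkovichCenter.Xstar s,
      ∀ Z ∈ BerkovichCenter.B x, BerkovichCenter.FieldFG Z.resCenter,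
      BerkovichCenter.FieldFG x.resScalar] := by
  have h (Z : BerkovichCenter.Centered x) (hZ : Z ∈ BerkovichCenter.B x) :
      BerkovichCenter.FieldFG Z.resCenter ↔ BerkovichCenter.FieldFG x.resScalar :=
    have := BerkovichCenter.locallyOfFiniteType_of_mem_B hZ
    Z.fieldFG_resCenter_iff
  tfae_have 1 → 3 := fun ⟨_, Z, hZ, hsurj⟩ =>
    (h Z hZ).mp (BerkovichCenter.fieldFG_resCenter_of_surjective hsurj)
  tfae_have 3 → 2 := fun h₃ Z hZ => (h Z hZ).mpr h₃
  tfae_have 2 → 3 := fun h₂ =>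
    have ⟨Z, hZ⟩ := hB
    (h Z hZ).mp (h₂ Z hZ)
  tfae_have 3 → 1 := fun h₃ => by
    obtain ⟨F, hF, hsurj⟩ := BerkovichCenter.AnPoint.exists_finset_of_fieldFG h₃
    obtain ⟨Z, hZ, hFZ⟩ := BerkovichCenter.exists_mem_B_forall_residue_mem_range hB F hF
    exact ⟨hx, Z, hZ, hsurj Z hFZ⟩
  tfae_finish
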